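/- Let $(\mathcal Q,\Delta)$ be a ($C^*$-algebraic) compact quantum group: $\mathcal Q$ is a unital $C^*$-algebra and $\Delta:\mathcal Q\to\mathcal Q\otimes\mathcal Q$ (minimal tensor product) is a unital $*$-homomorphism with $(\Delta\otimes \mathrm{id})\Delta=(\mathrm{id}\otimes\Delta)\Delta$ such that the linear spans of $\Delta(\mathcal Q)(1\otimes\mathcal Q)$ and of $\Delta(\mathcal Q)(\mathcal Q\otimes 1)$ are dense in $\mathcal Q\otimes\mathcal Q$. Let $h$ be its Haar state, i.e. the state with $(\mathrm{id}\otimes h)\Delta(a)=h(a)1=(h\otimes\mathrm{id})\Delta(a)$ for all $a\in\mathcal Q$. A right (resp. left) 2-cocycle is a unitary $\Omega\in\mathcal Q\otimes\mathcal Q$ with $(\mathrm{id}\otimes\Delta)(\Omega)(1\otimes\Omega)=(\Delta\otimes\mathrm{id})(\Omega)(\Omega\otimes1)$ (resp. $(1\otimes\Omega)(\mathrm{id}\otimes\Delta)(\Omega)=(\Omega\otimes1)(\Delta\otimes\mathrm{id})(\Omega)$); put $\Delta_\Omega(x)=\Delta(x)\Omega$ and ${}_\Omega\Delta(x)=\Omega\Delta(x)$.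 For a finite-dimensional Hilbert space $\mathcal K$, a unitary $X\in B(\mathcal K)\otimes\mathcal Q$ is called a unitary corepresentation on $\mathcal K$ if $(\mathrm{id}\otimes\Delta)(X)=X_{12}X_{13}$; a unitary right projective corepresentation if $(\mathrm{id}\otimes\Delta_\Omega)(X)=X_{12}X_{13}$ for some right 2-cocycle $\Omega$; and a unitary left projective corepresentation if $(\mathrm{id}\otimes{}_\Omega\Delta)(X)=X_{12}X_{13}$ for some left 2-cocycle $\Omega$. Let $\mathcal H$ be a finite-dimensional Hilbert space and $\bar{\mathcal H}=\{\bar x:x\in\mathcal H\}$ its conjugate, with $\langle\bar a,\bar b\rangle=\langle b,a\rangle$. Let $j:B(\mathcal H)\to B(\bar{\mathcal H})$, $j(T)\bar x=\overline{T^*x}$, and for $U\in B(\mathcal H)\otimes\mathcal Q$ put $U^c=(j\otimes\mathrm{id})(U^*)\in B(\bar{\mathcal H})\otimes\mathcal Q$ (so $U^c=\sum\bar e_{ij}\otimes u_{ij}^*$ if $U=\sum e_{ij}\otimes u_{ij}$ in matrix units). Suppose that $U$ is a unitary right projective corepresentation of $\mathcal Q$ on $\mathcal H$, and let $\psi(a)=(\mathrm{Tr}\otimes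 h)\bigl(U(a\otimes1)U^*\bigr)$ for $a\in B(\mathcal H)$. Then: 1. There is a unique $R\in B(\mathcal H)$ with $\psi(a)=\mathrm{Tr}(Ra)$ for all $a\in B(\mathcal H)$, and $R$ is positive and invertible. 2. Let $\bar{\mathcal H}_R$ be the vector space $\bar{\mathcal H}$ with the inner product $\langle\bar a,\bar b\rangle_R=\langle\overline{R^{1/2}a},\overline{R^{1/2}b}\rangle$. Then $U\otimes U^c:=U_{13}U^c_{23}\in B(\mathcal H\otimes\bar{\mathcal H}_R)\otimes\mathcal Q$ is a unitary corepresentation of $\mathcal Q$ on $\mathcal H\otimes\bar{\mathcal H}_R$. 3. $U^c$ is a unitary element of $B(\bar{\mathcal H}_R)\otimes\mathcal Q$. 4. Let $\rho\in B(\bar{\mathcal H})$, $\rho\bar x=\overline{Rx}$. Then $(\rho^{1/2}\otimes1)U^c(\rho^{-1/2}\otimes1)$ is a unitary left projective corepresentation of $\mathcal Q$ on $\bar{\mathcal H}$. -/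

import Mathlib

open scoped TensorProduct InnerProductSpace ENNReal ComplexOrder
open UniformSpace

noncomputable section

universe u v

/-- The Hilbert space tensor product: the completion of the algebraic tensor product. -/
def HilbTensor (K L : Type*) [NormedAddCommGroup K] [InnerProductSpace ℂ K]
    [NormedAddCommGroup L] [InnerProductSpace ℂ L] := Completion (K ⊗[ℂ] L)

namespace HilbTensor

variable {K L M : Type*} [NormedAddCommGroup K] [InnerProductSpace ℂ K]
    [NormedAddCommGroup L] [InnerProductSpace ℂ L]
    [NormedAddCommGroup M] [InnerProductSpace ℂ M]

instance : NormedAddCommGroup (HilbTensor K L) :=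
  inferInstanceAs (NormedAddCommGroup (Completion (K ⊗[ℂ] L)))
instance : InnerProductSpace ℂ (HilbTensor K L) :=
  inferInstanceAs (InnerProductSpace ℂ (Completion (K ⊗[ℂ] L)))
instance : CompleteSpace (HilbTensor K L) :=
  inferInstanceAs (CompleteSpace (Completion (K ⊗[ℂ] L)))

/-- The inclusion of the algebraic tensor product. -/
def incl (K L : Type*) [NormedAddCommGroup K] [InnerProductSpace ℂ K]
    [NormedAddCommGroup L] [InnerProductSpace ℂ L] : K ⊗[ℂ] L →ₗᵢ[ℂ] HilbTensor K L :=
  Completion.toComplₗᵢ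

lemma denseRange_incl : DenseRange (incl K L) := Completion.denseRange_coe

/-- Elementary tensors. -/
def tmul (x : K) (y : L) : HilbTensor K L := incl K L (x ⊗ₜ y)

lemma inner_tmul (x x' : K) (y y' : L) :
    ⟪tmul x y, tmul x' y'⟫_ℂ = ⟪x, x'⟫_ℂ * ⟪y, y'⟫_ℂ := by
  simp [tmul, LinearIsometry.inner_map_map]

lemma norm_tmul (x : K) (y : L) : ‖tmul x y‖ = ‖x‖ * ‖y‖ := by simp [tmul]

instance [Nontrivial K] [Nontrivial L] : Nontrivial (HilbTensor K L) := by
  obtain ⟨x, hx⟩ := exists_ne (0 : K)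
  obtain ⟨y, hy⟩ := exists_ne (0 : L)
  refine ⟨tmul x y, 0, fun h => ?_⟩
  have := congrArg norm h
  simp [norm_tmul, hx, hy] at this

lemma ext_clm {E : Type*} [NormedAddCommGroup E] [NormedSpace ℂ E]
    {S T : HilbTensor K L →L[ℂ] E} (h : ∀ x y, S (tmul x y) = T (tmul x y)) : S = T := by
  refine ContinuousLinearMap.coeFn_injective
    (denseRange_incl.equalizer S.continuous T.continuous (funext fun z => ?_))
  induction z using TensorProduct.induction_on with
  | zero => simp
  | tmul x y => exact h x y
  | add x y hx hy => simp_all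

/-- `S ⊗ T` on the Hilbert space tensor product. -/
def op (S : K →L[ℂ] K) (T : L →L[ℂ] L) : HilbTensor K L →L[ℂ] HilbTensor K L :=
  (TensorProduct.mapL S T).completion

@[simp] lemma op_incl (S : K →L[ℂ] K) (T : L →L[ℂ] L) (x : K ⊗[ℂ] L) :
    op S T (incl K L x) = incl K L (TensorProduct.mapL S T x) :=
  ContinuousLinearMap.completion_apply_coe _ _

@[simp] lemma op_tmul (S : K →L[ℂ] K) (T : L →L[ℂ] L) (x : K) (y : L) :
    op S T (tmul x y) = tmul (S x) (T y) := op_incl _ _ _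

lemma op_mul (S S' : K →L[ℂ] K) (T T' : L →L[ℂ] L) :
    op (S * S') (T * T') = op S T * op S' T' := ext_clm fun x y => by simp

lemma op_one : op (1 : K →L[ℂ] K) (1 : L →L[ℂ] L) = 1 := ext_clm fun x y => by simp

lemma star_op [CompleteSpace K] [CompleteSpace L] (S : K →L[ℂ] K) (T : L →L[ℂ] L) :
    star (op S T) = op (star S) (star T) := by
  refine ext_clm fun x y => ext_inner_right ℂ fun z => ?_
  refine DFunLike.congr_fun (ext_clm (S := innerSL ℂ (star (op S T) (tmul x y)))
    (T := innerSL ℂ (op (star S) (star T) (tmul x y))) fun c d => ?_) z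
  simp [ContinuousLinearMap.star_eq_adjoint, ContinuousLinearMap.adjoint_inner_left, inner_tmul]

/-- `(S, T) ↦ S ⊗ T` as a bilinear map. -/
def opₗ (K L : Type*) [NormedAddCommGroup K] [InnerProductSpace ℂ K]
    [NormedAddCommGroup L] [InnerProductSpace ℂ L] : (K →L[ℂ] K) →ₗ[ℂ] (L →L[ℂ] L) →ₗ[ℂ]
    (HilbTensor K L →L[ℂ] HilbTensor K L) :=
  LinearMap.mk₂ ℂ op
    (fun S S' T => ext_clm fun x y => by simp [tmul, TensorProduct.add_tmul])
    (fun c S T => ext_clm fun x y => by simp [tmul, ← TensorProduct.smul_tmul'])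
    (fun S T T' => ext_clm fun x y => by simp [tmul, TensorProduct.tmul_add])
    (fun c S T => ext_clm fun x y => by simp [tmul])

lemma norm_op_le (S : K →L[ℂ] K) (T : L →L[ℂ] L) : ‖op S T‖ ≤ ‖S‖ * ‖T‖ := by
  refine ContinuousLinearMap.opNorm_le_bound _ (by positivity) fun z => ?_
  refine denseRange_incl.induction_on (p := fun z => ‖op S T z‖ ≤ ‖S‖ * ‖T‖ * ‖z‖) z
    (isClosed_le (by fun_prop) (by fun_prop)) fun x => ?_
  rw [op_incl, LinearIsometry.norm_map, LinearIsometry.norm_map]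
  exact (TensorProduct.mapL S T).le_of_opNorm_le (TensorProduct.norm_mapL_le S T) x

lemma continuous_tmul : Continuous fun p : K × L => tmul p.1 p.2 :=
  (incl K L).continuous.comp TensorProduct.continuous_tmul

lemma dense_of_tmul {E : Type*} [AddCommGroup E] [Module ℂ E] (e : E →ₗ[ℂ] HilbTensor K L)
    {s : Set K} {t : Set L} (hs : Dense s) (ht : Dense t)
    (h : ∀ x ∈ s, ∀ y ∈ t, tmul x y ∈ LinearMap.range e) : DenseRange e := by
  have key : ∀ x y, tmul x y ∈ (LinearMap.range e).topologicalClosure := by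
    intro x y
    have : (x, y) ∈ closure (s ×ˢ t) := (hs.prod ht) (x, y)
    exact map_mem_closure (f := fun p : K × L => tmul p.1 p.2) continuous_tmul this
      fun p hp => h p.1 hp.1 p.2 hp.2
  have key2 : ∀ z, incl K L z ∈ (LinearMap.range e).topologicalClosure := by
    intro z
    induction z using TensorProduct.induction_on with
    | zero => simp
    | tmul x y => exact key x y
    | add x y hx hy => rw [map_add]; exact add_mem hx hy
  intro z
  exact closure_minimal (by rintro _ ⟨w, rfl⟩; exact key2 w)
    (LinearMap.range e).isClosed_topologicalClosure (denseRange_incl z)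

/-- The canonical unitary `(K ⊗ L) ⊗ M ≃ K ⊗ (L ⊗ M)`. -/
def assoc (K L M : Type*) [NormedAddCommGroup K] [InnerProductSpace ℂ K]
    [NormedAddCommGroup L] [InnerProductSpace ℂ L]
    [NormedAddCommGroup M] [InnerProductSpace ℂ M] :
    HilbTensor (HilbTensor K L) M ≃ₗᵢ[ℂ] HilbTensor K (HilbTensor L M) :=
  (TensorProduct.assoc ℂ K L M).extendOfIsometry
    ((incl (HilbTensor K L) M).toLinearMap ∘ₗ LinearMap.rTensor M (incl K L).toLinearMap)
    ((incl K (HilbTensor L M)).toLinearMap ∘ₗ LinearMap.lTensor K (incl L M).toLinearMap)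
    (dense_of_tmul _ (s := Set.range (incl K L)) (t := Set.univ) denseRange_incl dense_univ
      (by rintro _ ⟨x, rfl⟩ y -; exact ⟨x ⊗ₜ y, rfl⟩))
    (dense_of_tmul _ (s := Set.univ) (t := Set.range (incl L M)) dense_univ denseRange_incl
      (by rintro x - _ ⟨y, rfl⟩; exact ⟨x ⊗ₜ y, rfl⟩))
    (fun x => by
      have h1 := ((incl (HilbTensor K L) M).comp ((incl K L).rTensor M)).norm_map x
      have h2 := ((incl K (HilbTensor L M)).comp ((incl L M).lTensor K)).norm_map
        (TensorProduct.assoc ℂ K L M x)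
      rw [TensorProduct.norm_assoc] at h2
      exact h2.trans h1.symm)

lemma assoc_tmul (x : K) (y : L) (z : M) :
    assoc K L M (tmul (tmul x y) z) = tmul x (tmul y z) :=
  LinearEquiv.extendOfIsometry_eq _ _ _ _ _ _ ((x ⊗ₜ y) ⊗ₜ z)

end HilbTensor

/-- A unital `*`-representation of a complex `*`-algebra on a nonzero Hilbert space. -/
structure HilbRep (T : Type*) [Ring T] [Algebra ℂ T] [StarRing T] where
  space : Type u
  [normed : NormedAddCommGroup space]
  [inner : InnerProductSpace ℂ space]
  [complete : CompleteSpace space]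
  [nontrivial : Nontrivial space]
  hom : T →⋆ₐ[ℂ] (space →L[ℂ] space)

namespace HilbRep

attribute [instance] HilbRep.normed HilbRep.inner HilbRep.complete HilbRep.nontrivial

variable {S T : Type*} [Ring S] [Algebra ℂ S] [StarRing S] [StarModule ℂ S]
  [Ring T] [Algebra ℂ T] [StarRing T] [StarModule ℂ T]

/-- The tensor product of two representations, as a representation of the algebraic tensor
product. -/
def tensorHom (π : HilbRep S) (σ : HilbRep T) :
    S ⊗[ℂ] T →⋆ₐ[ℂ] (HilbTensor π.space σ.space →L[ℂ] HilbTensor π.space σ.space) :=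
    { Algebra.TensorProduct.algHomOfLinearMapTensorProduct
        (TensorProduct.lift ((HilbTensor.opₗ π.space σ.space).compl₁₂
          π.hom.toAlgHom.toLinearMap σ.hom.toAlgHom.toLinearMap))
        (fun a a' b b' => by simp [HilbTensor.opₗ, HilbTensor.op_mul])
        (by simp [HilbTensor.opₗ, HilbTensor.op_one]) with
      map_star' := fun x => by
        induction x using TensorProduct.induction_on with
        | zero => simp
        | tmul a b =>
          change HilbTensor.op (π.hom (star a)) (σ.hom (star b)) =
            star (HilbTensor.op (π.hom a) (σ.hom b))
          rw [HilbTensor.star_op, map_star π.hom, map_star σ.hom]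
        | add x y hx hy => simp_all }

@[simp] lemma tensorHom_tmul (π : HilbRep S) (σ : HilbRep T) (a : S) (b : T) :
    tensorHom π σ (a ⊗ₜ b) = HilbTensor.op (π.hom a) (σ.hom b) := rfl

end HilbRep

/-! ### The minimal tensor product -/

section MinTensor

/-- A bounded product of C⋆-algebras is a C⋆-algebra. -/
def lpCStarAlgebra {I : Type*} (D : I → Type*) [∀ i, CStarAlgebra (D i)]
    [∀ i, Nontrivial (D i)] : CStarAlgebra (lp D ∞) where

variable (A B : Type u) [CStarAlgebra A] [CStarAlgebra B]

/-- The `ℓ^∞`-product of the algebras `B(K ⊗ L)`, over all representations of `A` on `K` and of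
`B` on `L`. -/
def SpatialAmbient : Type (u + 1) := lp (fun i : HilbRep.{u} A × HilbRep.{u} B =>
  (HilbTensor i.1.space i.2.space →L[ℂ] HilbTensor i.1.space i.2.space)) ∞

instance : CStarAlgebra (SpatialAmbient A B) :=
  lpCStarAlgebra fun i : HilbRep.{u} A × HilbRep.{u} B =>
    (HilbTensor i.1.space i.2.space →L[ℂ] HilbTensor i.1.space i.2.space)

variable {A B}

namespace SpatialAmbient

/-- The coordinate at a pair of representations. -/
def coord (π : HilbRep.{u} A) (σ : HilbRep.{u} B) : SpatialAmbient A B →⋆ₐ[ℂ]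
    (HilbTensor π.space σ.space →L[ℂ] HilbTensor π.space σ.space) where
  toFun x := x.1 (π, σ)
  map_one' := rfl
  map_mul' _ _ := rfl
  map_zero' := rfl
  map_add' _ _ := rfl
  commutes' _ := rfl
  map_star' _ := rfl

lemma norm_coord_le (π : HilbRep.{u} A) (σ : HilbRep.{u} B) (x : SpatialAmbient A B) :
    ‖coord π σ x‖ ≤ ‖x‖ := lp.norm_apply_le_norm ENNReal.top_ne_zero x (π, σ)

lemma ext {x y : SpatialAmbient A B} (h : ∀ π σ, coord π σ x = coord π σ y) : x = y :=
  Subtype.ext (funext fun i => h i.1 i.2)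

end SpatialAmbient

lemma norm_tensorHom_le (x : A ⊗[ℂ] B) :
    ∃ C : ℝ, ∀ (π : HilbRep.{u} A) (σ : HilbRep.{u} B), ‖π.tensorHom σ x‖ ≤ C := by
  induction x using TensorProduct.induction_on with
  | zero => exact ⟨0, by simp⟩
  | tmul a b =>
    refine ⟨‖a‖ * ‖b‖, fun π σ => ?_⟩
    rw [HilbRep.tensorHom_tmul]
    refine (HilbTensor.norm_op_le _ _).trans ?_
    gcongr
    · exact NonUnitalStarAlgHom.norm_apply_le π.hom a
    · exact NonUnitalStarAlgHom.norm_apply_le σ.hom b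
  | add x y hx hy =>
    obtain ⟨C, hC⟩ := hx
    obtain ⟨D, hD⟩ := hy
    refine ⟨C + D, fun π σ => ?_⟩
    rw [map_add]
    exact (norm_add_le _ _).trans (add_le_add (hC π σ) (hD π σ))

variable (A B) in
/-- The map `A ⊙ B → ∏ B(K ⊗ L)` from the algebraic tensor product. -/
def spatialIncl : A ⊗[ℂ] B →⋆ₐ[ℂ] SpatialAmbient A B where
  toFun x := ⟨fun i => i.1.tensorHom i.2 x, memℓp_infty (by
    obtain ⟨C, hC⟩ := norm_tensorHom_le x
    exact ⟨C, by rintro _ ⟨i, rfl⟩; exact hC i.1 i.2⟩)⟩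
  map_one' := SpatialAmbient.ext fun π σ => map_one (π.tensorHom σ)
  map_mul' x y := SpatialAmbient.ext fun π σ => map_mul (π.tensorHom σ) x y
  map_zero' := SpatialAmbient.ext fun π σ => map_zero (π.tensorHom σ)
  map_add' x y := SpatialAmbient.ext fun π σ => map_add (π.tensorHom σ) x y
  commutes' c := SpatialAmbient.ext fun π σ => AlgHomClass.commutes (π.tensorHom σ) c
  map_star' x := SpatialAmbient.ext fun π σ => map_star (π.tensorHom σ) x

variable (A B) in
/-- The closure of the image of the algebraic tensor product `A ⊙ B`. -/
def minTensorSubalgebra : StarSubalgebra ℂ (SpatialAmbient A B) :=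
  (spatialIncl A B).range.topologicalClosure

variable (A B) in
/-- The minimal (spatial) tensor product of two unital C⋆-algebras: the closure of the image of
the algebraic tensor product `A ⊙ B` in the product of the algebras `B(K ⊗ L)`. -/
def MinTensor : Type (u + 1) := minTensorSubalgebra A B

instance : CStarAlgebra (MinTensor A B) :=
  StarSubalgebra.cstarAlgebra (minTensorSubalgebra A B)
    (h_closed := StarSubalgebra.isClosed_topologicalClosure _)

namespace MinTensor

/-- The inclusion into the product of the algebras `B(K ⊗ L)`. -/
def val : MinTensor A B →⋆ₐ[ℂ] SpatialAmbient A B := (minTensorSubalgebra A B).subtype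

variable (A B) in
/-- The canonical map from the algebraic tensor product. -/
def incl : A ⊗[ℂ] B →⋆ₐ[ℂ] MinTensor A B :=
  (spatialIncl A B).codRestrict (minTensorSubalgebra A B)
    (fun x => StarSubalgebra.le_topologicalClosure _ ⟨x, rfl⟩)

/-- The elementary tensor `a ⊗ b`. -/
def tmul (a : A) (b : B) : MinTensor A B := incl A B (a ⊗ₜ b)

lemma denseRange_incl : DenseRange (incl A B) := by
  intro x
  have hx : (x.1 : SpatialAmbient A B) ∈ closure ((spatialIncl A B).range : Set (SpatialAmbient A B)) :=
    x.2
  refine (closure_subtype (p := fun y => y ∈ minTensorSubalgebra A B)).mpr ?_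
  convert! hx
  ext y
  constructor
  · rintro ⟨_, ⟨z, rfl⟩, rfl⟩; exact ⟨z, rfl⟩
  · rintro ⟨z, rfl⟩; exact ⟨_, ⟨z, rfl⟩, rfl⟩

/-- The representation `π ⊗ σ` of the minimal tensor product on `K ⊗ L`. -/
def eval (π : HilbRep.{u} A) (σ : HilbRep.{u} B) :
    MinTensor A B →⋆ₐ[ℂ] (HilbTensor π.space σ.space →L[ℂ] HilbTensor π.space σ.space) :=
  (SpatialAmbient.coord π σ).comp val

@[simp] lemma eval_incl (π : HilbRep.{u} A) (σ : HilbRep.{u} B) (x : A ⊗[ℂ] B) :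
    eval π σ (incl A B x) = π.tensorHom σ x := rfl

lemma norm_eval_le (π : HilbRep.{u} A) (σ : HilbRep.{u} B) (x : MinTensor A B) :
    ‖eval π σ x‖ ≤ ‖x‖ := SpatialAmbient.norm_coord_le π σ (val x)

end MinTensor

end MinTensor

/-! ### States, the GNS representation, slice maps -/

section Slices

variable {A : Type u} [CStarAlgebra A] [PartialOrder A] [StarOrderedRing A]

/-- The canonical vector of the GNS space. -/
def gnsVector (f : A →ₚ[ℂ] ℂ) : f.GNS := ((f.toPreGNS 1 : f.PreGNS) : f.GNS)

lemma norm_gns (f : A →ₚ[ℂ] ℂ) (a : A) :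
    ‖f.gnsStarAlgHom a (gnsVector f)‖ ^ 2 = (f (star a * a)).re := by
  have h : f.gnsStarAlgHom a (gnsVector f) = ((f.toPreGNS a : f.PreGNS) : f.GNS) := by
    simp [gnsVector]
  rw [h, Completion.norm_coe]
  have := f.preGNS_norm_sq (f.toPreGNS a)
  rw [f.ofPreGNS_toPreGNS] at this
  rw [← this]
  norm_cast

lemma norm_gnsVector (f : A →ₚ[ℂ] ℂ) (hf : f 1 = 1) : ‖gnsVector f‖ = 1 := by
  have := norm_gns f 1
  simp [hf] at this
  exact this.resolve_right fun h => by linarith [norm_nonneg (gnsVector f)]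

lemma inner_gns (f : A →ₚ[ℂ] ℂ) (a : A) :
    ⟪gnsVector f, f.gnsStarAlgHom a (gnsVector f)⟫_ℂ = f a := by
  have h : f.gnsStarAlgHom a (gnsVector f) = ((f.toPreGNS a : f.PreGNS) : f.GNS) := by
    simp [gnsVector]
  rw [h, gnsVector, Completion.inner_coe, f.preGNS_inner_def]
  simp

/-- The GNS representation of a state. -/
def gnsRep (f : A →ₚ[ℂ] ℂ) (hf : f 1 = 1) : HilbRep.{u} A where
  space := f.GNS
  nontrivial := ⟨gnsVector f, 0, fun h => by simpa [h] using norm_gnsVector f hf⟩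
  hom := f.gnsStarAlgHom

lemma exists_state (a : A) [Nontrivial A] (ha : 0 ≤ a) :
    ∃ f : A →ₚ[ℂ] ℂ, f 1 = 1 ∧ f a = ‖a‖ := by
  let F : (ℂ × ℂ) →ₗ[ℂ] ℂ := LinearMap.fst ℂ ℂ ℂ + (‖a‖ : ℂ) • LinearMap.snd ℂ ℂ ℂ
  let E : (ℂ × ℂ) →ₗ[ℂ] A :=
    (LinearMap.toSpanSingleton ℂ A 1).comp (LinearMap.fst ℂ ℂ ℂ) +
      (LinearMap.toSpanSingleton ℂ A a).comp (LinearMap.snd ℂ ℂ ℂ)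
  have hF : ∀ x, F x = x.1 + ‖a‖ * x.2 := fun x => rfl
  have hE : ∀ x, E x = x.1 • (1 : A) + x.2 • a := fun x => rfl
  have hspec : (‖a‖ : ℂ) ∈ spectrum ℂ a := by
    have := CStarAlgebra.norm_mem_spectrum_of_nonneg ha
    exact (spectrum.algebraMap_mem_iff ℂ).mpr this
  have hle : ∀ x, ‖F x‖ ≤ 1 * ‖E x‖ := by
    intro x
    rw [one_mul]
    refine spectrum.norm_le_norm_of_mem (𝕜 := ℂ) (a := E x) ?_
    have h3 : Polynomial.aeval a (Polynomial.C x.1 + Polynomial.C x.2 * Polynomial.X) = E x := by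
      simp only [map_add, map_mul, Polynomial.aeval_C, Polynomial.aeval_X]
      rw [hE, Algebra.algebraMap_eq_smul_one, Algebra.algebraMap_eq_smul_one, smul_one_mul]
    have h4 : Polynomial.eval (‖a‖ : ℂ) (Polynomial.C x.1 + Polynomial.C x.2 * Polynomial.X)
        = F x := by
      simp only [Polynomial.eval_add, Polynomial.eval_C, Polynomial.eval_mul, Polynomial.eval_X]
      rw [hF]
      ring
    rw [← h3, ← h4]
    exact spectrum.subset_polynomial_aeval (𝕜 := ℂ) a _ ⟨_, hspec, rfl⟩
  let g := F.compLeftInverse E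
  have hg : ∀ x, g ⟨E x, LinearMap.mem_range_self E x⟩ = F x := fun x =>
    (F.compLeftInverse_apply_of_bdd E ⟨1, hle⟩ x _ rfl)
  obtain ⟨φ, hφ, hφn⟩ := exists_extension_norm_eq _ g
  have hn : ‖φ‖ ≤ 1 := by
    rw [hφn]
    refine ContinuousLinearMap.opNorm_le_bound _ zero_le_one ?_
    rintro ⟨_, x, rfl⟩
    rw [hg]
    exact hle x
  have h1 : φ 1 = 1 := by
    have := hφ ⟨E (1, 0), LinearMap.mem_range_self E _⟩
    rw [hg] at this
    simpa [hE, hF] using this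
  have h2 : φ a = ‖a‖ := by
    have := hφ ⟨E (0, 1), LinearMap.mem_range_self E _⟩
    rw [hg] at this
    simpa [hE, hF] using this
  have hb : ∀ x, ‖φ x‖ ≤ ‖x‖ := fun x => by simpa using φ.le_of_opNorm_le hn x
  have him : ∀ c : A, IsSelfAdjoint c → (φ c).im = 0 := by
    intro c hc
    have key : ∀ t : ℝ, (φ c).re ^ 2 + ((φ c).im + t) ^ 2 ≤ ‖c‖ ^ 2 + t ^ 2 := by
      intro t
      have e1 : φ (c + ((t : ℂ) * Complex.I) • (1 : A)) = φ c + t * Complex.I := by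
        simp [h1]
      have e2 := hb (c + ((t : ℂ) * Complex.I) • (1 : A))
      have e3 : ‖c + ((t : ℂ) * Complex.I) • (1 : A)‖ ^ 2 ≤ ‖c‖ ^ 2 + t ^ 2 := by
        rw [sq, ← CStarRing.norm_star_mul_self]
        have : star (c + ((t : ℂ) * Complex.I) • (1 : A)) * (c + ((t : ℂ) * Complex.I) • (1 : A))
            = c * c + ((t ^ 2 : ℝ) : ℂ) • (1 : A) := by
          simp only [star_add, star_smul, hc.star_eq, star_one, add_mul, mul_add, smul_mul_assoc,
            mul_smul_comm, one_mul, mul_one]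
          simp only [Complex.star_def, map_mul, Complex.conj_ofReal, Complex.conj_I]
          have : (t : ℂ) * Complex.I * (t * -Complex.I) = ((t ^ 2 : ℝ) : ℂ) := by
            push_cast
            linear_combination (-(t : ℂ) ^ 2) * Complex.I_sq
          rw [smul_add, smul_smul, this]
          module
        rw [this]
        refine (norm_add_le _ _).trans ?_
        gcongr
        · rw [sq]; exact norm_mul_le _ _
        · simp [norm_smul]
      have e4 : ‖φ c + t * Complex.I‖ ^ 2 = (φ c).re ^ 2 + ((φ c).im + t) ^ 2 := by
        rw [Complex.sq_norm, Complex.normSq_apply]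
        simp
        ring
      rw [← e4, ← e1]
      exact (pow_le_pow_left₀ (norm_nonneg _) e2 2).trans e3
    by_contra hne
    have := key ((‖c‖ ^ 2 + 1) / (φ c).im)
    have h3 : (φ c).im * ((‖c‖ ^ 2 + 1) / (φ c).im) = ‖c‖ ^ 2 + 1 := by field_simp
    nlinarith [sq_nonneg (φ c).re, sq_nonneg (φ c).im, sq_nonneg ‖c‖]
  have hpos : ∀ c : A, 0 ≤ c → 0 ≤ φ c := by
    intro c hc
    have hsa : IsSelfAdjoint c := .of_nonneg hc
    rw [Complex.nonneg_iff]
    refine ⟨?_, (him c hsa).symm⟩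
    have hle' : c ≤ algebraMap ℝ A ‖c‖ := hsa.le_algebraMap_norm_self
    have e1 : ‖algebraMap ℝ A ‖c‖ - c‖ ≤ ‖c‖ := by
      have : ‖algebraMap ℝ A ‖c‖ - c‖ ≤ ‖algebraMap ℝ A ‖c‖‖ :=
        CStarAlgebra.norm_le_norm_of_nonneg_of_le (sub_nonneg.mpr hle') (sub_le_self _ hc)
      simpa using this
    have e2 := (hb (algebraMap ℝ A ‖c‖ - c)).trans e1
    have e3 : φ (algebraMap ℝ A ‖c‖ - c) = ‖c‖ - φ c := by
      rw [map_sub, IsScalarTower.algebraMap_apply ℝ ℂ A, Algebra.algebraMap_eq_smul_one, map_smul,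
        h1]
      simp
    rw [e3] at e2
    have e4 := (Complex.abs_re_le_norm _).trans e2
    have := (abs_le.mp e4).2
    simp at this
    linarith
  exact ⟨PositiveLinearMap.mk₀ φ.toLinearMap hpos, h1, h2⟩

lemma exists_rep_norm_le (A : Type u) [CStarAlgebra A] [Nontrivial A] (a : A) :
    ∃ π : HilbRep.{u} A, ‖a‖ ≤ ‖π.hom a‖ := by
  let _ := CStarAlgebra.spectralOrder A
  let _ := CStarAlgebra.spectralOrderedRing A
  obtain ⟨f, hf, hfa⟩ := exists_state (star a * a) (star_mul_self_nonneg a)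
  refine ⟨gnsRep f hf, ?_⟩
  have h1 := norm_gns f a
  rw [hfa, Complex.ofReal_re, CStarRing.norm_star_mul_self, ← sq] at h1
  have h2 : ‖f.gnsStarAlgHom a (gnsVector f)‖ = ‖a‖ :=
    (pow_left_inj₀ (norm_nonneg _) (norm_nonneg _) two_ne_zero).mp h1
  have h3 := (f.gnsStarAlgHom a).le_opNorm (gnsVector f)
  rw [h2, norm_gnsVector f hf, mul_one] at h3
  exact h3

lemma exists_rep_vector (f : A →ₚ[ℂ] ℂ) (hf : f 1 = 1) :
    ∃ (σ : HilbRep.{u} A) (ζ : σ.space), ‖ζ‖ = 1 ∧ ∀ a, ⟪ζ, σ.hom a ζ⟫_ℂ = f a :=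
  ⟨gnsRep f hf, gnsVector f, norm_gnsVector f hf, inner_gns f⟩

lemma norm_le_of_compression {K L : Type*} [NormedAddCommGroup K] [InnerProductSpace ℂ K]
    [NormedAddCommGroup L] [InnerProductSpace ℂ L] (T : K →L[ℂ] K) (S : L →L[ℂ] L) (J : K → L)
    (hJ : ∀ ξ, ‖J ξ‖ = ‖ξ‖) (h : ∀ ξ η, ⟪η, T ξ⟫_ℂ = ⟪J η, S (J ξ)⟫_ℂ) : ‖T‖ ≤ ‖S‖ := by
  refine ContinuousLinearMap.opNorm_le_bound _ (norm_nonneg _) fun ξ => ?_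
  have h2 : ‖T ξ‖ * ‖T ξ‖ ≤ ‖T ξ‖ * (‖S‖ * ‖ξ‖) := by
    rw [← inner_self_eq_norm_mul_norm (𝕜 := ℂ), h]
    refine (RCLike.re_le_norm _).trans ((norm_inner_le_norm _ _).trans ?_)
    rw [hJ]
    gcongr
    rw [← hJ ξ]
    exact ContinuousLinearMap.le_opNorm _ _
  rcases (norm_nonneg (T ξ)).eq_or_lt with h0 | h0
  · rw [← h0]; positivity
  · exact le_of_mul_le_mul_left h2 h0

end Slices

section Slices

variable {A B : Type u} [CStarAlgebra A] [CStarAlgebra B] [PartialOrder A]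

/-- The slice map `id ⊗ h : b ⊗ a ↦ h(a) b` on the algebraic tensor product. -/
def sliceRightAlg (h : A →ₚ[ℂ] ℂ) : B ⊗[ℂ] A →ₗ[ℂ] B :=
  (TensorProduct.rid ℂ B).toLinearMap ∘ₗ LinearMap.lTensor B h.toLinearMap

/-- The slice map `h ⊗ id : a ⊗ b ↦ h(a) b` on the algebraic tensor product. -/
def sliceLeftAlg (h : A →ₚ[ℂ] ℂ) : A ⊗[ℂ] B →ₗ[ℂ] B :=
  (TensorProduct.lid ℂ B).toLinearMap ∘ₗ LinearMap.rTensor B h.toLinearMap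

@[simp] lemma sliceRightAlg_tmul (h : A →ₚ[ℂ] ℂ) (b : B) (a : A) :
    sliceRightAlg h (b ⊗ₜ[ℂ] a) = h a • b := rfl

@[simp] lemma sliceLeftAlg_tmul (h : A →ₚ[ℂ] ℂ) (b : B) (a : A) :
    sliceLeftAlg h (a ⊗ₜ[ℂ] b) = h a • b := rfl

lemma norm_sliceRightAlg_le [StarOrderedRing A] (h : A →ₚ[ℂ] ℂ) (hh : h 1 = 1) (x : B ⊗[ℂ] A) :
    ‖sliceRightAlg h x‖ ≤ 1 * ‖MinTensor.incl B A x‖ := by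
  rw [one_mul]
  by_cases h0 : sliceRightAlg h x = 0
  · rw [h0, norm_zero]; exact norm_nonneg _
  have hB : Nontrivial B := ⟨_, _, h0⟩
  obtain ⟨π, hπ⟩ := exists_rep_norm_le B (sliceRightAlg h x)
  obtain ⟨σ, ζ, hζ, hσ⟩ := exists_rep_vector h hh
  refine hπ.trans (le_trans ?_ (MinTensor.norm_eval_le π σ (MinTensor.incl B A x)))
  rw [MinTensor.eval_incl]
  refine norm_le_of_compression _ _ (fun ξ => HilbTensor.tmul ξ ζ)
    (fun ξ => by rw [HilbTensor.norm_tmul, hζ, mul_one]) fun ξ η => ?_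
  clear hπ h0
  induction x using TensorProduct.induction_on with
  | zero => simp
  | tmul b a =>
    rw [HilbRep.tensorHom_tmul, HilbTensor.op_tmul, HilbTensor.inner_tmul, hσ,
      sliceRightAlg_tmul, map_smul, smul_apply, inner_smul_right, mul_comm]
  | add x y hx hy => rw [map_add, map_add, map_add, add_apply, add_apply, inner_add_right,
      inner_add_right, hx, hy]

lemma norm_sliceLeftAlg_le [StarOrderedRing A] (h : A →ₚ[ℂ] ℂ) (hh : h 1 = 1) (x : A ⊗[ℂ] B) :
    ‖sliceLeftAlg h x‖ ≤ 1 * ‖MinTensor.incl A B x‖ := by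
  rw [one_mul]
  by_cases h0 : sliceLeftAlg h x = 0
  · rw [h0, norm_zero]; exact norm_nonneg _
  have hB : Nontrivial B := ⟨_, _, h0⟩
  obtain ⟨π, hπ⟩ := exists_rep_norm_le B (sliceLeftAlg h x)
  obtain ⟨σ, ζ, hζ, hσ⟩ := exists_rep_vector h hh
  refine hπ.trans (le_trans ?_ (MinTensor.norm_eval_le σ π (MinTensor.incl A B x)))
  rw [MinTensor.eval_incl]
  refine norm_le_of_compression _ _ (fun ξ => HilbTensor.tmul ζ ξ)
    (fun ξ => by rw [HilbTensor.norm_tmul, hζ, one_mul]) fun ξ η => ?_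
  clear hπ h0
  induction x using TensorProduct.induction_on with
  | zero => simp
  | tmul a b =>
    rw [HilbRep.tensorHom_tmul, HilbTensor.op_tmul, HilbTensor.inner_tmul, hσ,
      sliceLeftAlg_tmul, map_smul, smul_apply, inner_smul_right]
  | add x y hx hy => rw [map_add, map_add, map_add, add_apply, add_apply, inner_add_right,
      inner_add_right, hx, hy]

namespace MinTensor

/-- The slice map `id ⊗ h : B ⊗ A → B`, the continuous extension of `b ⊗ a ↦ h(a) b`. -/
def sliceRight (h : A →ₚ[ℂ] ℂ) : MinTensor B A →L[ℂ] B :=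
  (sliceRightAlg h).extendOfNorm (incl B A).toAlgHom.toLinearMap

/-- The slice map `h ⊗ id : A ⊗ B → B`, the continuous extension of `a ⊗ b ↦ h(a) b`. -/
def sliceLeft (h : A →ₚ[ℂ] ℂ) : MinTensor A B →L[ℂ] B :=
  (sliceLeftAlg h).extendOfNorm (incl A B).toAlgHom.toLinearMap

lemma sliceRight_tmul [StarOrderedRing A] (h : A →ₚ[ℂ] ℂ) (hh : h 1 = 1) (b : B) (a : A) :
    sliceRight h (tmul b a) = h a • b :=
  LinearMap.extendOfNorm_eq (e := (incl B A).toAlgHom.toLinearMap) denseRange_incl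
    ⟨1, norm_sliceRightAlg_le h hh⟩ (b ⊗ₜ a)

lemma sliceLeft_tmul [StarOrderedRing A] (h : A →ₚ[ℂ] ℂ) (hh : h 1 = 1) (b : B) (a : A) :
    sliceLeft h (tmul a b) = h a • b :=
  LinearMap.extendOfNorm_eq (e := (incl A B).toAlgHom.toLinearMap) denseRange_incl
    ⟨1, norm_sliceLeftAlg_le h hh⟩ (a ⊗ₜ b)

end MinTensor

end Slices

/-! ### Compact quantum groups -/

section CQG

variable {Q : Type u} [CStarAlgebra Q]

/-- The representation `(π ⊗ σ) ∘ Δ`. -/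
abbrev comulRep (Δ : Q →⋆ₐ[ℂ] MinTensor Q Q) (π σ : HilbRep.{u} Q) : HilbRep.{u} Q where
  space := HilbTensor π.space σ.space
  hom := (MinTensor.eval π σ).comp Δ

variable (Q) in
/-- The product of the algebras `B(K₁ ⊗ K₂ ⊗ K₃)` over all triples of representations of `Q`. The
minimal tensor product `Q ⊗ Q ⊗ Q` is the norm closure of `Q ⊙ Q ⊙ Q` therein, and equations in
`Q ⊗ Q ⊗ Q` are stated as equations in this algebra. -/
abbrev TripleOp := ∀ π₁ π₂ π₃ : HilbRep.{u} Q,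
  (HilbTensor (HilbTensor π₁.space π₂.space) π₃.space →L[ℂ]
    HilbTensor (HilbTensor π₁.space π₂.space) π₃.space)

/-- Transport of operators along `(K ⊗ L) ⊗ M ≃ K ⊗ (L ⊗ M)`. -/
def assocConj {K L M : Type*} [NormedAddCommGroup K] [InnerProductSpace ℂ K]
    [NormedAddCommGroup L] [InnerProductSpace ℂ L] [NormedAddCommGroup M] [InnerProductSpace ℂ M]
    (T : HilbTensor K (HilbTensor L M) →L[ℂ] HilbTensor K (HilbTensor L M)) :
    HilbTensor (HilbTensor K L) M →L[ℂ] HilbTensor (HilbTensor K L) M :=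
  ((HilbTensor.assoc K L M).symm.toContinuousLinearEquiv : _ →L[ℂ] _) ∘L T ∘L
    ((HilbTensor.assoc K L M).toContinuousLinearEquiv : _ →L[ℂ] _)

/-- `(Δ ⊗ id)(x)`, for `x ∈ Q ⊗ Q`. -/
def comulTensorId (Δ : Q →⋆ₐ[ℂ] MinTensor Q Q) (x : MinTensor Q Q) : TripleOp Q :=
  fun π₁ π₂ π₃ => MinTensor.eval (comulRep Δ π₁ π₂) π₃ x

/-- `(id ⊗ Δ)(x)`, for `x ∈ Q ⊗ Q`. -/
def idTensorComul (Δ : Q →⋆ₐ[ℂ] MinTensor Q Q) (x : MinTensor Q Q) : TripleOp Q :=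
  fun π₁ π₂ π₃ => assocConj (MinTensor.eval π₁ (comulRep Δ π₂ π₃) x)

/-- `x ⊗ 1`, for `x ∈ Q ⊗ Q`. -/
def tensorOne (x : MinTensor Q Q) : TripleOp Q :=
  fun π₁ π₂ π₃ => HilbTensor.op (MinTensor.eval π₁ π₂ x) (1 : π₃.space →L[ℂ] π₃.space)

/-- `1 ⊗ x`, for `x ∈ Q ⊗ Q`. -/
def oneTensor (x : MinTensor Q Q) : TripleOp Q :=
  fun π₁ π₂ π₃ => assocConj (HilbTensor.op (1 : π₁.space →L[ℂ] π₁.space) (MinTensor.eval π₂ π₃ x))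

variable (Q) in
/-- A C⋆-algebraic compact quantum group. -/
structure CompactQuantumGroup where
  /-- The comultiplication. -/
  comul : Q →⋆ₐ[ℂ] MinTensor Q Q
  coassoc : ∀ a, comulTensorId comul (comul a) = idTensorComul comul (comul a)
  dense_one_tmul : Dense
    (Submodule.span ℂ {x | ∃ a b, x = comul a * MinTensor.tmul 1 b} : Set (MinTensor Q Q))
  dense_tmul_one : Dense
    (Submodule.span ℂ {x | ∃ a b, x = comul a * MinTensor.tmul b 1} : Set (MinTensor Q Q))

namespace CompactQuantumGroup

variable (G : CompactQuantumGroup Q)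

/-- `h` is the Haar state. -/
def IsHaarState [PartialOrder Q] (h : Q →ₚ[ℂ] ℂ) : Prop :=
  h 1 = 1 ∧ ∀ a, MinTensor.sliceRight h (G.comul a) = h a • (1 : Q) ∧
    MinTensor.sliceLeft h (G.comul a) = h a • (1 : Q)

/-- Right 2-cocycles: `(id ⊗ Δ)(Ω)(1 ⊗ Ω) = (Δ ⊗ id)(Ω)(Ω ⊗ 1)`. -/
def IsRightCocycle (Ω : MinTensor Q Q) : Prop :=
  Ω ∈ unitary (MinTensor Q Q) ∧
    idTensorComul G.comul Ω * oneTensor Ω = comulTensorId G.comul Ω * tensorOne Ω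

/-- Left 2-cocycles: `(1 ⊗ Ω)(id ⊗ Δ)(Ω) = (Ω ⊗ 1)(Δ ⊗ id)(Ω)`. -/
def IsLeftCocycle (Ω : MinTensor Q Q) : Prop :=
  Ω ∈ unitary (MinTensor Q Q) ∧
    oneTensor Ω * idTensorComul G.comul Ω = tensorOne Ω * comulTensorId G.comul Ω

end CompactQuantumGroup

/-! ### Corepresentations on finite-dimensional Hilbert spaces -/

variable {K : Type v} [NormedAddCommGroup K] [InnerProductSpace ℂ K] [CompleteSpace K]

/-- `X ↦ X₁₂`, from `B(K) ⊗ Q` to `B(K) ⊗ Q ⊗ Q`. -/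
def leg₁₂ : (K →L[ℂ] K) ⊗[ℂ] Q →ₗ[ℂ] (K →L[ℂ] K) ⊗[ℂ] MinTensor Q Q :=
  LinearMap.lTensor _
    ((MinTensor.incl Q Q).toAlgHom.toLinearMap ∘ₗ (TensorProduct.mk ℂ Q Q).flip 1)

/-- `X ↦ X₁₃`, from `B(K) ⊗ Q` to `B(K) ⊗ Q ⊗ Q`. -/
def leg₁₃ : (K →L[ℂ] K) ⊗[ℂ] Q →ₗ[ℂ] (K →L[ℂ] K) ⊗[ℂ] MinTensor Q Q :=
  LinearMap.lTensor _
    ((MinTensor.incl Q Q).toAlgHom.toLinearMap ∘ₗ TensorProduct.mk ℂ Q Q 1)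

namespace CompactQuantumGroup

variable (G : CompactQuantumGroup Q)

/-- The twisted comultiplication `Δ_Ω(x) = Δ(x) Ω`. -/
def comulRight (Ω : MinTensor Q Q) : Q →ₗ[ℂ] MinTensor Q Q :=
  LinearMap.mulRight ℂ Ω ∘ₗ G.comul.toAlgHom.toLinearMap

/-- The twisted comultiplication `_ΩΔ(x) = Ω Δ(x)`. -/
def comulLeft (Ω : MinTensor Q Q) : Q →ₗ[ℂ] MinTensor Q Q :=
  LinearMap.mulLeft ℂ Ω ∘ₗ G.comul.toAlgHom.toLinearMap

/-- `X ∈ B(K) ⊗ Q` is a unitary corepresentation of `Q` on `K`. -/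
def IsUnitaryCorep (X : (K →L[ℂ] K) ⊗[ℂ] Q) : Prop :=
  X ∈ unitary ((K →L[ℂ] K) ⊗[ℂ] Q) ∧
    LinearMap.lTensor (K →L[ℂ] K) G.comul.toAlgHom.toLinearMap X = leg₁₂ X * leg₁₃ X

/-- `X ∈ B(K) ⊗ Q` is a unitary right projective corepresentation of `Q` on `K`. -/
def IsUnitaryRightProjectiveCorep (X : (K →L[ℂ] K) ⊗[ℂ] Q) : Prop :=
  X ∈ unitary ((K →L[ℂ] K) ⊗[ℂ] Q) ∧
    ∃ Ω, G.IsRightCocycle Ω ∧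
      LinearMap.lTensor (K →L[ℂ] K) (G.comulRight Ω) X = leg₁₂ X * leg₁₃ X

/-- `X ∈ B(K) ⊗ Q` is a unitary left projective corepresentation of `Q` on `K`. -/
def IsUnitaryLeftProjectiveCorep (X : (K →L[ℂ] K) ⊗[ℂ] Q) : Prop :=
  X ∈ unitary ((K →L[ℂ] K) ⊗[ℂ] Q) ∧
    ∃ Ω, G.IsLeftCocycle Ω ∧
      LinearMap.lTensor (K →L[ℂ] K) (G.comulLeft Ω) X = leg₁₂ X * leg₁₃ X

end CompactQuantumGroup

/-- `X ⊗ Y = X₁₃ Y₂₃ ∈ B(K ⊗ L) ⊗ Q`, for `X ∈ B(K) ⊗ Q` and `Y ∈ B(L) ⊗ Q`. -/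
def corepTensor {L : Type v} [NormedAddCommGroup L] [InnerProductSpace ℂ L]
    (X : (K →L[ℂ] K) ⊗[ℂ] Q) (Y : (L →L[ℂ] L) ⊗[ℂ] Q) :
    (HilbTensor K L →L[ℂ] HilbTensor K L) ⊗[ℂ] Q :=
  LinearMap.rTensor Q ((HilbTensor.opₗ K L).flip 1) X *
    LinearMap.rTensor Q (HilbTensor.opₗ K L 1) Y

end CQG

/-! ### The conjugate Hilbert space and its twisted version -/

section Conjugate

/-- The conjugate `H̄` of a complex vector space: the same additive group, with scalars acting through
complex conjugation. -/
def Conj (H : Type v) : Type v := H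

namespace Conj

variable {H : Type v} [NormedAddCommGroup H]

instance : NormedAddCommGroup (Conj H) := inferInstanceAs (NormedAddCommGroup H)

/-- The map `x ↦ x̄`. -/
def bar : H ≃+ Conj H := AddEquiv.refl H

variable [InnerProductSpace ℂ H]

instance : Module ℂ (Conj H) where
  smul c x := bar (starRingEnd ℂ c • bar.symm x)
  one_smul x := by change bar (starRingEnd ℂ 1 • bar.symm x) = x; simp
  mul_smul c d x := by
    change bar (starRingEnd ℂ (c * d) • bar.symm x) =
      bar (starRingEnd ℂ c • starRingEnd ℂ d • bar.symm x)
    rw [map_mul, mul_smul]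
  smul_zero c := by change bar (starRingEnd ℂ c • bar.symm 0) = 0; simp
  smul_add c x y := by
    change bar (starRingEnd ℂ c • bar.symm (x + y)) =
      bar (starRingEnd ℂ c • bar.symm x) + bar (starRingEnd ℂ c • bar.symm y)
    simp
  add_smul c d x := by
    change bar (starRingEnd ℂ (c + d) • bar.symm x) =
      bar (starRingEnd ℂ c • bar.symm x) + bar (starRingEnd ℂ d • bar.symm x)
    rw [map_add, add_smul, map_add]
  zero_smul x := by change bar (starRingEnd ℂ 0 • bar.symm x) = 0; simp

lemma bar_smul (c : ℂ) (x : H) : bar (c • x) = starRingEnd ℂ c • bar x := by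
  change c • x = starRingEnd ℂ (starRingEnd ℂ c) • x
  rw [Complex.conj_conj]

lemma bar_symm_smul (c : ℂ) (x : Conj H) : bar.symm (c • x) = starRingEnd ℂ c • bar.symm x := rfl

/-- The inner product `⟨ā, b̄⟩ = ⟨b, a⟩`. -/
instance : InnerProductSpace ℂ (Conj H) where
  norm_smul_le c x := by
    change ‖starRingEnd ℂ c • bar.symm x‖ ≤ ‖c‖ * ‖bar.symm x‖
    rw [norm_smul, RCLike.norm_conj]
  inner x y := ⟪bar.symm y, bar.symm x⟫_ℂ
  norm_sq_eq_re_inner x := norm_sq_eq_re_inner (𝕜 := ℂ) (bar.symm x)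
  conj_inner_symm x y := inner_conj_symm (bar.symm y) (bar.symm x)
  add_left x y z := inner_add_right (bar.symm z) (bar.symm x) (bar.symm y)
  smul_left x y c := by
    change ⟪bar.symm y, starRingEnd ℂ c • bar.symm x⟫_ℂ = _
    rw [inner_smul_right]

instance [FiniteDimensional ℂ H] : FiniteDimensional ℂ (Conj H) :=
  Module.Finite.of_surjective
    ({ toFun := bar, map_add' := map_add bar, map_smul' := bar_smul } :
      H →ₛₗ[starRingEnd ℂ] Conj H) bar.surjective

lemma inner_def (x y : Conj H) : ⟪x, y⟫_ℂ = ⟪bar.symm y, bar.symm x⟫_ℂ := rfl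

instance [CompleteSpace H] : CompleteSpace (Conj H) := inferInstanceAs (CompleteSpace H)

/-- The operator `x̄ ↦ (T x)‾` on the conjugate space. -/
def barOp (T : H →L[ℂ] H) : Conj H →L[ℂ] Conj H where
  toFun x := bar (T (bar.symm x))
  map_add' x y := by simp
  map_smul' c x := by
    rw [bar_symm_smul, map_smul, bar_smul, Complex.conj_conj]
    rfl
  cont := T.continuous

@[simp] lemma barOp_apply (T : H →L[ℂ] H) (x : Conj H) : barOp T x = bar (T (bar.symm x)) := rfl

/-- The canonical linear anti-multiplicative map `j : B(H) → B(H̄)`, `j(T) x̄ = (T* x)‾`. In matrix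
units, `j(e_{kl}) = ē_{lk}`. -/
def j [CompleteSpace H] : (H →L[ℂ] H) →ₗ[ℂ] (Conj H →L[ℂ] Conj H) where
  toFun T := barOp (star T)
  map_add' S T := by ext x; simp
  map_smul' c T := by ext x; simp [bar_smul]

end Conj

/-- The twisted conjugate space `H̄_R`: the vector space `H̄`, with the inner product of
`R^{1/2} a` and `R^{1/2} b` for `ā, b̄`, where `R` is a positive invertible operator on `H`. -/
def TwistedConj {H : Type v} [NormedAddCommGroup H] [InnerProductSpace ℂ H] [CompleteSpace H]
    (_R : {R : H →L[ℂ] H // IsStrictlyPositive R}) : Type v := Conj H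

namespace TwistedConj

variable {H : Type v} [NormedAddCommGroup H] [InnerProductSpace ℂ H] [CompleteSpace H]
  (R : {R : H →L[ℂ] H // IsStrictlyPositive R})

/-- The map `ā ↦ (R^{1/2} a)‾`. -/
def sqrtMap : Conj H →ₗ[ℂ] Conj H :=
  (Conj.barOp ((R : H →L[ℂ] H) ^ (1 / 2 : ℝ))).toLinearMap

lemma sqrtMap_injective : Function.Injective (sqrtMap R) := by
  intro x y hxy
  have h : ((R : H →L[ℂ] H) ^ (1 / 2 : ℝ)) * ((R : H →L[ℂ] H) ^ (1 / 2 : ℝ)) = R := by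
    rw [← CFC.sqrt_eq_rpow, CFC.sqrt_mul_sqrt_self _ R.2.nonneg]
  obtain ⟨S, hS⟩ := R.2.isUnit.exists_left_inv
  have hxy' : ((R : H →L[ℂ] H) ^ (1 / 2 : ℝ)) (Conj.bar.symm x) =
      ((R : H →L[ℂ] H) ^ (1 / 2 : ℝ)) (Conj.bar.symm y) := hxy
  have key : ∀ z : H, S (((R : H →L[ℂ] H) ^ (1 / 2 : ℝ)) (((R : H →L[ℂ] H) ^ (1 / 2 : ℝ)) z)) = z :=
    fun z => by
      have : (S * ((R : H →L[ℂ] H) ^ (1 / 2 : ℝ) * (R : H →L[ℂ] H) ^ (1 / 2 : ℝ))) z = z := by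
        rw [h, hS]; rfl
      exact this
  have := congrArg (fun z => S (((R : H →L[ℂ] H) ^ (1 / 2 : ℝ)) z)) hxy'
  simp only [key] at this
  exact this

instance : NormedAddCommGroup (TwistedConj R) :=
  NormedAddCommGroup.induced (Conj H) (Conj H) (sqrtMap R) (sqrtMap_injective R)

/-- The inner product `⟨ā, b̄⟩_R = ⟨(R^{1/2} a)‾, (R^{1/2} b)‾⟩`. -/
instance : InnerProductSpace ℂ (TwistedConj R) where
  toModule := inferInstanceAs (Module ℂ (Conj H))
  norm_smul_le c x :=
    ((congrArg norm ((sqrtMap R).map_smul c x)).trans (norm_smul c (sqrtMap R x))).le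
  inner x y := ⟪sqrtMap R x, sqrtMap R y⟫_ℂ
  norm_sq_eq_re_inner x := norm_sq_eq_re_inner (𝕜 := ℂ) (sqrtMap R x)
  conj_inner_symm x y := inner_conj_symm (sqrtMap R x) (sqrtMap R y)
  add_left x y z :=
    (congrArg (fun w => ⟪w, sqrtMap R z⟫_ℂ) ((sqrtMap R).map_add x y)).trans
      (inner_add_left (sqrtMap R x) (sqrtMap R y) (sqrtMap R z))
  smul_left x y c :=
    (congrArg (fun w => ⟪w, sqrtMap R y⟫_ℂ) ((sqrtMap R).map_smul c x)).trans
      (inner_smul_left (sqrtMap R x) (sqrtMap R y) c)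

/-- The identity map `H̄ → H̄_R`. -/
def equiv : Conj H ≃ₗ[ℂ] TwistedConj R := LinearEquiv.refl ℂ (Conj H)

lemma inner_def (x y : TwistedConj R) : ⟪x, y⟫_ℂ =
    ⟪sqrtMap R ((equiv R).symm x), sqrtMap R ((equiv R).symm y)⟫_ℂ := rfl

instance [FiniteDimensional ℂ H] : FiniteDimensional ℂ (TwistedConj R) :=
  inferInstanceAs (FiniteDimensional ℂ (Conj H))

instance [FiniteDimensional ℂ H] : CompleteSpace (TwistedConj R) := FiniteDimensional.complete ℂ _

/-- An operator on `H̄`, regarded as an operator on `H̄_R`. -/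
def transfer [FiniteDimensional ℂ H] :
    (Conj H →L[ℂ] Conj H) →ₗ[ℂ] (TwistedConj R →L[ℂ] TwistedConj R) where
  toFun T := LinearMap.toContinuousLinearMap
    ((equiv R).toLinearMap ∘ₗ T.toLinearMap ∘ₗ (equiv R).symm.toLinearMap)
  map_add' S T := by ext x; simp
  map_smul' c T := by ext x; simp

end TwistedConj

end Conjugate

section Conclusion

variable {Q : Type u} [CStarAlgebra Q] {H : Type v} [NormedAddCommGroup H]
  [InnerProductSpace ℂ H] [CompleteSpace H]

/-- `U^c = (j ⊗ id)(U*) ∈ B(H̄) ⊗ Q`. -/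
def contragredient (U : (H →L[ℂ] H) ⊗[ℂ] Q) : (Conj H →L[ℂ] Conj H) ⊗[ℂ] Q :=
  LinearMap.rTensor Q Conj.j (star U)

/-- `U^c` regarded as an element of `B(H̄_R) ⊗ Q`. -/
def contragredientTwisted [FiniteDimensional ℂ H] (U : (H →L[ℂ] H) ⊗[ℂ] Q)
    (R : {R : H →L[ℂ] H // IsStrictlyPositive R}) :
    (TwistedConj R →L[ℂ] TwistedConj R) ⊗[ℂ] Q :=
  LinearMap.rTensor Q (TwistedConj.transfer R) (contragredient U)

/-- The trace on `B(H)`. -/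
def opTrace (H : Type v) [NormedAddCommGroup H] [InnerProductSpace ℂ H] :
    (H →L[ℂ] H) →ₗ[ℂ] ℂ :=
  LinearMap.trace ℂ H ∘ₗ ContinuousLinearMap.coeLM ℂ

/-- The functional `ψ(a) = (Tr ⊗ h)(Ad_U(a)) = (Tr ⊗ h)(U (a ⊗ 1) U*)`. -/
def traceHaar [PartialOrder Q] (h : Q →ₚ[ℂ] ℂ) (U : (H →L[ℂ] H) ⊗[ℂ] Q) (a : H →L[ℂ] H) : ℂ :=
  LinearMap.mul' ℂ ℂ (TensorProduct.map (opTrace H) h.toLinearMap (U * (a ⊗ₜ 1) * star U))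

/-- `(ρ^{1/2} ⊗ 1) U^c (ρ^{-1/2} ⊗ 1)`, where `ρ x̄ = (R x)‾`. -/
def conjugateCorep (U : (H →L[ℂ] H) ⊗[ℂ] Q) (R : H →L[ℂ] H) :
    (Conj H →L[ℂ] Conj H) ⊗[ℂ] Q :=
  ((Conj.barOp R ^ (1 / 2 : ℝ)) ⊗ₜ 1) * contragredient U *
    ((Conj.barOp R ^ (-(1 / 2) : ℝ)) ⊗ₜ 1)

end Conclusion

end

/-! ### Induction principles and slices -/

namespace HilbTensor

variable {K L : Type*} [NormedAddCommGroup K] [InnerProductSpace ℂ K]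
  [NormedAddCommGroup L] [InnerProductSpace ℂ L]

/-! Write `V = U^c` and let `Ω` be the right cocycle of `U`. Taking adjoints in the identity for `U`
and applying the anti-multiplicative `j` shows that `V` satisfies the left projective identity for
`Ω*`. By cyclicity of the trace, the density `R` of `ψ` satisfies `j(R) = (id ⊗ h)(V*V)`; since `R`
is self-adjoint, this operator is `ρ`. In `V*V` the cocycle cancels, so invariance of `h` gives
`V*(ρ ⊗ 1)V = ρ ⊗ 1` (`star_mul_sliceFunctional_mul`). Equivalently, `V` is an isometry over `H̄_R`,
and `W = (ρ^{1/2} ⊗ 1)V(ρ^{-1/2} ⊗ 1)` is an isometry over `H̄`.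

The difficulty is to pass from isometric to unitary, since matrices over a C⋆-algebra may contain
proper isometries. In `Y = U ⊗ V` the cocycles `Ω*` and `Ω` meet and cancel, so `Y` is an isometric
genuine corepresentation, and such a `Y` is unitary (`mem_unitary_of_star_mul_self`). Indeed `P =
(id ⊗ h)(YY*)` satisfies `Y(P ⊗ 1)Y* = P ⊗ 1`, so `Y` commutes with `P ⊗ 1` and with `p ⊗ 1`, where
`p` is the projection onto the kernel of `P`. Now `(Tr ⊗ h)(pY(pY)*) = 0`; if this forces `(Tr ⊗
h)((pY)*pY) = Tr(p)` to vanish, then `P` is invertible and `Y` has a right inverse. Finally, `V` is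
coisometric because `U` is isometric and `U₁₃V₂₃` is unitary.

What remains is that `h(xx*) = 0` implies `h(x*x) = 0` (`map_star_mul_self_eq_zero`), although `h`
need be neither faithful nor tracial. This rests on `map_mul_eq_zero_of_forall`, a computation with
coassociativity and both density conditions. The same fact, applied to `U(T ⊗ 1)`, makes `ψ`
faithful, hence `R` invertible. -/

lemma induction_on_closed {p : HilbTensor K L → Prop} (hc : IsClosed {z | p z})
    (htmul : ∀ x y, p (tmul x y)) (hadd : ∀ z w, p z → p w → p (z + w)) (z : HilbTensor K L) :
    p z := by
  refine denseRange_incl.induction_on z hc fun x => ?_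
  induction x using TensorProduct.induction_on with
  | zero => simpa [tmul] using htmul 0 0
  | tmul x y => exact htmul x y
  | add x y hx hy => rw [map_add]; exact hadd _ _ hx hy

lemma assoc_symm_tmul {M : Type*} [NormedAddCommGroup M] [InnerProductSpace ℂ M]
    (x : K) (y : L) (z : M) :
    (assoc K L M).symm (tmul x (tmul y z)) = tmul (tmul x y) z := by
  rw [← assoc_tmul, LinearIsometryEquiv.symm_apply_apply]

lemma tmul_add (x : K) (y y' : L) : tmul x (y + y') = tmul x y + tmul x y' := by
  simp [tmul, TensorProduct.tmul_add]

lemma add_tmul (x x' : K) (y : L) : tmul (x + x') y = tmul x y + tmul x' y := by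
  simp [tmul, TensorProduct.add_tmul]

lemma continuous_tmul_left (x : K) : Continuous fun y : L => tmul x y :=
  continuous_tmul.comp (Continuous.prodMk_right x)

lemma continuous_tmul_right (y : L) : Continuous fun x : K => tmul x y :=
  continuous_tmul.comp (Continuous.prodMk_left y)

end HilbTensor

lemma HilbRep.continuous_hom {A : Type*} [CStarAlgebra A] (π : HilbRep A) :
    Continuous π.hom :=
  (LinearMap.mkContinuous π.hom.toAlgHom.toLinearMap 1
    (fun x => by rw [one_mul]; exact NonUnitalStarAlgHom.norm_apply_le π.hom x)).continuous

namespace MinTensor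

section

variable {A B : Type u} [CStarAlgebra A] [CStarAlgebra B]

lemma induction_on_closed {p : MinTensor A B → Prop} (hc : IsClosed {z | p z})
    (htmul : ∀ a b, p (tmul a b)) (hadd : ∀ z w, p z → p w → p (z + w)) (z : MinTensor A B) :
    p z := by
  refine denseRange_incl.induction_on z hc fun x => ?_
  induction x using TensorProduct.induction_on with
  | zero => simpa [tmul] using htmul 0 0
  | tmul x y => exact htmul x y
  | add x y hx hy => rw [map_add]; exact hadd _ _ hx hy

lemma continuous_eval (π : HilbRep.{u} A) (σ : HilbRep.{u} B) : Continuous (eval π σ) :=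
  (LinearMap.mkContinuous (eval π σ).toAlgHom.toLinearMap 1
    (fun x => by rw [one_mul]; exact norm_eval_le π σ x)).continuous

lemma eval_tmul (π : HilbRep.{u} A) (σ : HilbRep.{u} B) (a : A) (b : B) :
    eval π σ (tmul a b) = HilbTensor.op (π.hom a) (σ.hom b) := rfl

lemma tmul_mul_tmul (a a' : A) (b b' : B) : tmul a b * tmul a' b' = tmul (a * a') (b * b') := by
  simp [tmul, ← map_mul]

lemma star_tmul (a : A) (b : B) : star (tmul a b) = tmul (star a) (star b) := by
  simp [tmul, ← map_star]

end

variable {A B : Type u} [CStarAlgebra A] [CStarAlgebra B] [PartialOrder A] [StarOrderedRing A]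
  {h : A →ₚ[ℂ] ℂ}

lemma sliceLeft_mul_one_tmul (h1 : h 1 = 1) (z : MinTensor A B) (c : B) :
    sliceLeft h (z * tmul 1 c) = sliceLeft h z * c := by
  induction z using induction_on_closed with
  | hc => exact isClosed_eq (by fun_prop) (by fun_prop)
  | htmul a b => rw [tmul_mul_tmul, sliceLeft_tmul h h1, sliceLeft_tmul h h1, mul_one,
      smul_mul_assoc]
  | hadd z w hz hw => rw [add_mul, map_add, map_add, hz, hw, add_mul]

lemma sliceRight_tmul_one_mul (h1 : h 1 = 1) (z : MinTensor B A) (c : B) :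
    sliceRight h (tmul c 1 * z) = c * sliceRight h z := by
  induction z using induction_on_closed with
  | hc => exact isClosed_eq (by fun_prop) (by fun_prop)
  | htmul a b => rw [tmul_mul_tmul, sliceRight_tmul h h1, sliceRight_tmul h h1, one_mul,
      mul_smul_comm]
  | hadd z w hz hw => rw [mul_add, map_add, map_add, hz, hw, mul_add]

/-- If `ζ` implements `h` as a vector functional, slicing by `h` is compression to vectors of the
form `ξ ⊗ ζ`. Triple products exist here only as families of operators, so `h` is applied to their
legs through such vectors. -/
lemma inner_eval_eq_sliceRight (h1 : h 1 = 1) (π : HilbRep.{u} B) {σ : HilbRep.{u} A}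
    {ζ : σ.space} (hσ : ∀ a, ⟪ζ, σ.hom a ζ⟫_ℂ = h a) (z : MinTensor B A) (ξ η : π.space) :
    ⟪HilbTensor.tmul ξ ζ, eval π σ z (HilbTensor.tmul η ζ)⟫_ℂ =
      ⟪ξ, π.hom (sliceRight h z) η⟫_ℂ := by
  have := continuous_eval π σ
  have := π.continuous_hom
  induction z using induction_on_closed with
  | hc => exact isClosed_eq (by fun_prop) (by fun_prop)
  | htmul b a =>
    rw [eval_tmul, HilbTensor.op_tmul, HilbTensor.inner_tmul, hσ, sliceRight_tmul h h1, map_smul,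
      smul_apply, inner_smul_right, mul_comm]
  | hadd z w hz hw =>
    rw [map_add, map_add, map_add, add_apply, add_apply, inner_add_right, inner_add_right, hz, hw]

lemma inner_eval_eq_sliceLeft (h1 : h 1 = 1) (π : HilbRep.{u} B) {σ : HilbRep.{u} A}
    {ζ : σ.space} (hσ : ∀ a, ⟪ζ, σ.hom a ζ⟫_ℂ = h a) (z : MinTensor A B) (ξ η : π.space) :
    ⟪HilbTensor.tmul ζ ξ, eval σ π z (HilbTensor.tmul ζ η)⟫_ℂ =
      ⟪ξ, π.hom (sliceLeft h z) η⟫_ℂ := by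
  have := continuous_eval σ π
  have := π.continuous_hom
  induction z using induction_on_closed with
  | hc => exact isClosed_eq (by fun_prop) (by fun_prop)
  | htmul b a =>
    rw [eval_tmul, HilbTensor.op_tmul, HilbTensor.inner_tmul, hσ, sliceLeft_tmul h h1, map_smul,
      smul_apply, inner_smul_right]
  | hadd z w hz hw =>
    rw [map_add, map_add, map_add, add_apply, add_apply, inner_add_right, inner_add_right, hz, hw]

end MinTensor

/-! ### The null space of the Haar state is a two-sided ideal -/

namespace CompactQuantumGroup

open MinTensor

variable {Q : Type u} [CStarAlgebra Q] {G : CompactQuantumGroup Q}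

lemma induction_comul_mul_one_tmul {p : MinTensor Q Q → Prop} (hc : IsClosed {z | p z})
    (hmul : ∀ a b, p (G.comul a * tmul 1 b)) (h0 : p 0) (hadd : ∀ z w, p z → p w → p (z + w))
    (hsmul : ∀ (c : ℂ) z, p z → p (c • z)) (z : MinTensor Q Q) : p z := by
  refine G.dense_one_tmul.induction (fun z hz => ?_) hc z
  induction hz using Submodule.span_induction with
  | mem z hz => obtain ⟨a, b, rfl⟩ := hz; exact hmul a b
  | zero => exact h0
  | add z w _ _ hz hw => exact hadd z w hz hw
  | smul c z _ hz => exact hsmul c z hz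

/-- The adjoint turns the dense span of the `Δ(a)(b ⊗ 1)` into that of the `(b ⊗ 1)Δ(a)`. -/
lemma induction_tmul_one_mul_comul {p : MinTensor Q Q → Prop} (hc : IsClosed {z | p z})
    (hmul : ∀ a b, p (tmul b 1 * G.comul a)) (h0 : p 0) (hadd : ∀ z w, p z → p w → p (z + w))
    (hsmul : ∀ (c : ℂ) z, p z → p (c • z)) (z : MinTensor Q Q) : p z := by
  suffices ∀ z, p (star z) by simpa using this (star z)
  intro z
  refine G.dense_tmul_one.induction (P := fun z => p (star z)) (fun z hz => ?_)
    (hc.preimage continuous_star) z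
  induction hz using Submodule.span_induction with
  | mem z hz =>
    obtain ⟨a, b, rfl⟩ := hz
    rw [star_mul, star_tmul, star_one, ← map_star]
    exact hmul _ _
  | zero => simpa using h0
  | add z w _ _ hz hw => rw [star_add]; exact hadd _ _ hz hw
  | smul c z _ hz => rw [star_smul]; exact hsmul _ _ hz

variable [PartialOrder Q] [StarOrderedRing Q] {h : Q →ₚ[ℂ] ℂ}

/-- For `z = Δ(a)(1 ⊗ b)` the slice is `(h ⊗ id)(Δ(xa)) b = h(xa) b = 0`, and such `z` span a dense
subspace. -/
lemma IsHaarState.sliceLeft_comul_mul_eq_zero (hh : G.IsHaarState h) {x : Q}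
    (hx : ∀ b, h (x * b) = 0) (z : MinTensor Q Q) : sliceLeft h (G.comul x * z) = 0 := by
  induction z using G.induction_comul_mul_one_tmul with
  | hc => exact isClosed_eq (by fun_prop) (by fun_prop)
  | hmul a b => rw [← mul_assoc, ← map_mul, sliceLeft_mul_one_tmul hh.1, (hh.2 _).2, hx]; simp
  | h0 => simp
  | hadd z w hz hw => rw [mul_add, map_add, hz, hw, add_zero]
  | hsmul c z hz => rw [mul_smul_comm, map_smul, hz, smul_zero]

section

variable {σ : HilbRep.{u} Q} {ζ : σ.space}

lemma IsHaarState.inner_comul_tmul_left (hh : G.IsHaarState h)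
    (hσ : ∀ a, ⟪ζ, σ.hom a ζ⟫_ℂ = h a) (a : Q) (ξ η : σ.space) :
    ⟪HilbTensor.tmul ζ ξ, eval σ σ (G.comul a) (HilbTensor.tmul ζ η)⟫_ℂ = h a * ⟪ξ, η⟫_ℂ := by
  rw [inner_eval_eq_sliceLeft hh.1 σ hσ, (hh.2 a).2, map_smul, map_one, smul_apply,
    one_apply_eq_self, inner_smul_right]

lemma IsHaarState.inner_comul_tmul_right (hh : G.IsHaarState h)
    (hσ : ∀ a, ⟪ζ, σ.hom a ζ⟫_ℂ = h a) (a : Q) (ξ η : σ.space) :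
    ⟪HilbTensor.tmul ξ ζ, eval σ σ (G.comul a) (HilbTensor.tmul η ζ)⟫_ℂ = h a * ⟪ξ, η⟫_ℂ := by
  rw [inner_eval_eq_sliceRight hh.1 σ hσ, (hh.2 a).1, map_smul, map_one, smul_apply,
    one_apply_eq_self, inner_smul_right]

/-- Evaluating `h` in the first leg of `(Δ ⊗ id)(w)`. -/
lemma IsHaarState.inner_comulTensorId_eq_zero (hh : G.IsHaarState h)
    (hσ : ∀ a, ⟪ζ, σ.hom a ζ⟫_ℂ = h a) {v : HilbTensor σ.space σ.space}
    (hv : ∀ ξ, ⟪HilbTensor.tmul ζ ξ, v⟫_ℂ = 0) (w : MinTensor Q Q) :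
    ⟪HilbTensor.tmul (HilbTensor.tmul ζ ζ) ζ, comulTensorId G.comul w σ σ σ
      ((HilbTensor.assoc _ _ _).symm (HilbTensor.tmul ζ v))⟫_ℂ = 0 := by
  have := continuous_eval (comulRep G.comul σ σ) σ
  unfold comulTensorId
  induction w using MinTensor.induction_on_closed with
  | hc => exact isClosed_eq (by fun_prop) (by fun_prop)
  | hadd z w hz hw => rw [map_add, add_apply, inner_add_right, hz, hw, add_zero]
  | htmul b a =>
    rw [eval_tmul]
    -- For `w = b ⊗ a`, invariance collapses `Δ(b)` to the scalar `h(b)`. The operator of `a` in the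
    -- last leg is moved to the left vector, which leaves a pairing of the kind that `hv` kills.
    have key : ∀ v : HilbTensor σ.space σ.space,
        ⟪HilbTensor.tmul (HilbTensor.tmul ζ ζ) ζ,
          HilbTensor.op ((comulRep G.comul σ σ).hom b) (σ.hom a)
            ((HilbTensor.assoc _ _ _).symm (HilbTensor.tmul ζ v))⟫_ℂ =
        h b * ⟪HilbTensor.tmul ζ (star (σ.hom a) ζ), v⟫_ℂ := by
      intro v
      have := HilbTensor.continuous_tmul_left (L := HilbTensor σ.space σ.space) ζ
      induction v using HilbTensor.induction_on_closed with
      | hc => exact isClosed_eq (by fun_prop) (by fun_prop)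
      | hadd z w hz hw =>
        rw [HilbTensor.tmul_add, map_add, map_add, inner_add_right, hz, hw, inner_add_right,
          mul_add]
      | htmul ξ η =>
        rw [HilbTensor.assoc_symm_tmul, HilbTensor.op_tmul, HilbTensor.inner_tmul,
          HilbTensor.inner_tmul]
        rw [ContinuousLinearMap.star_eq_adjoint, ContinuousLinearMap.adjoint_inner_left,
          ← mul_assoc]
        congr 1
        exact hh.inner_comul_tmul_left hσ b ζ ξ
    rw [key, hv, mul_zero]

/-- Evaluating `h` in the third leg of `(id ⊗ Δ)(w)`. -/
lemma IsHaarState.inner_idTensorComul (hh : G.IsHaarState h)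
    (hσ : ∀ a, ⟪ζ, σ.hom a ζ⟫_ℂ = h a) (u : HilbTensor σ.space σ.space) (η : σ.space)
    (w : MinTensor Q Q) :
    ⟪HilbTensor.tmul u ζ, idTensorComul G.comul w σ σ σ
      (HilbTensor.tmul (HilbTensor.tmul ζ η) ζ)⟫_ℂ =
    ⟪u, HilbTensor.tmul (σ.hom (sliceRight h w) ζ) η⟫_ℂ := by
  have := continuous_eval σ (comulRep G.comul σ σ)
  have := σ.continuous_hom
  have := HilbTensor.continuous_tmul_right (K := σ.space) η
  have e : ∀ w, idTensorComul G.comul w σ σ σ (HilbTensor.tmul (HilbTensor.tmul ζ η) ζ) =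
      (HilbTensor.assoc _ _ _).symm (eval σ (comulRep G.comul σ σ) w
        (HilbTensor.tmul ζ (HilbTensor.tmul η ζ))) := fun w => by
    rw [← HilbTensor.assoc_tmul]; rfl
  rw [e]
  induction w using MinTensor.induction_on_closed with
  | hc => exact isClosed_eq (by fun_prop) (by fun_prop)
  | hadd z w hz hw =>
    rw [map_add, add_apply, map_add, inner_add_right, hz, hw, map_add, map_add, add_apply,
      HilbTensor.add_tmul, inner_add_right]
  | htmul g x =>
    rw [eval_tmul, HilbTensor.op_tmul]
    have := HilbTensor.continuous_tmul_right (K := HilbTensor σ.space σ.space) ζ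
    induction u using HilbTensor.induction_on_closed with
    | hc => exact isClosed_eq (by fun_prop) (by fun_prop)
    | hadd z w hz hw => rw [HilbTensor.add_tmul, inner_add_left, hz, hw, inner_add_left]
    | htmul ξ ξ' =>
      rw [← LinearIsometryEquiv.inner_map_map (HilbTensor.assoc _ _ _),
        LinearIsometryEquiv.apply_symm_apply, HilbTensor.assoc_tmul, HilbTensor.inner_tmul,
        HilbTensor.inner_tmul, sliceRight_tmul h hh.1, map_smul, smul_apply, inner_smul_right]
      have := hh.inner_comul_tmul_right hσ x ξ' η
      rw [show (comulRep G.comul σ σ).hom x = eval σ σ (G.comul x) from rfl, this]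
      ring

end

/-- If `h(x b) = 0` for all `b`, then `h(b x) = 0` for all `b`. -/
theorem IsHaarState.map_mul_eq_zero_of_forall (hh : G.IsHaarState h) {x : Q}
    (hx : ∀ b, h (x * b) = 0) (q : Q) : h (q * x) = 0 := by
  obtain ⟨σ, ζ, -, hσ⟩ := exists_rep_vector h hh.1
  have hE := continuous_eval σ σ
  -- With `s = (id ⊗ h)(Δ(a)(1 ⊗ x))` this says `(h ⊗ h)(Δ(b)(s ⊗ y)) = 0`. It comes from evaluating
  -- `h ⊗ h ⊗ h` in two ways on `(Δ ⊗ id)((b ⊗ 1)Δ(a)) (1 ⊗ Δ(x)(y ⊗ 1))`.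
  have key : ∀ a b y, ⟪HilbTensor.tmul ζ ζ, eval σ σ (G.comul b * tmul 1 y)
      (HilbTensor.tmul (σ.hom (sliceRight h (G.comul a * tmul 1 x)) ζ) ζ)⟫_ℂ = 0 := by
    intro a b y
    -- Vector form of `(h ⊗ id)(Δ(x)(y ⊗ 1)) = 0`, which makes the first evaluation (`h1`) vanish.
    have hv : ∀ ξ, ⟪HilbTensor.tmul ζ ξ, eval σ σ (G.comul x)
        (HilbTensor.tmul (σ.hom y ζ) ζ)⟫_ℂ = 0 := by
      intro ξ
      have e : eval σ σ (G.comul x) (HilbTensor.tmul (σ.hom y ζ) ζ) =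
          eval σ σ (G.comul x * tmul y 1) (HilbTensor.tmul ζ ζ) := by
        rw [map_mul, eval_tmul, mul_apply_eq_comp, HilbTensor.op_tmul, map_one,
          one_apply_eq_self]
      rw [e, inner_eval_eq_sliceLeft hh.1 σ hσ, hh.sliceLeft_comul_mul_eq_zero hx]
      simp
    have h1 := hh.inner_comulTensorId_eq_zero hσ hv (tmul b 1 * G.comul a)
    have h2 := hh.inner_idTensorComul hσ (star (eval σ σ (G.comul b)) (HilbTensor.tmul ζ ζ))
      (σ.hom y ζ) (G.comul a * tmul 1 x)
    -- Coassociativity enters here: `(Δ ⊗ id)((b ⊗ 1)Δ(a)) = (Δ(b) ⊗ 1)(id ⊗ Δ)(Δ(a))`.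
    have e1 : comulTensorId G.comul (tmul b 1 * G.comul a) σ σ σ =
        HilbTensor.op (eval σ σ (G.comul b)) 1 * idTensorComul G.comul (G.comul a) σ σ σ := by
      rw [← G.coassoc]
      unfold comulTensorId
      rw [map_mul, eval_tmul, map_one]
      rfl
    -- The factor `1 ⊗ Δ(x)` is absorbed: `(id ⊗ Δ)(Δ(a)) (1 ⊗ Δ(x)) = (id ⊗ Δ)(Δ(a)(1 ⊗ x))`, so
    -- `h` in the third leg produces `s`.
    have e2 : idTensorComul G.comul (G.comul a * tmul 1 x) σ σ σ
        (HilbTensor.tmul (HilbTensor.tmul ζ (σ.hom y ζ)) ζ) =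
        idTensorComul G.comul (G.comul a) σ σ σ ((HilbTensor.assoc _ _ _).symm
          (HilbTensor.tmul ζ (eval σ σ (G.comul x) (HilbTensor.tmul (σ.hom y ζ) ζ)))) := by
      change (HilbTensor.assoc _ _ _).symm (eval σ (comulRep G.comul σ σ) (G.comul a * tmul 1 x)
        (HilbTensor.assoc _ _ _ (HilbTensor.tmul (HilbTensor.tmul ζ (σ.hom y ζ)) ζ))) =
        (HilbTensor.assoc _ _ _).symm (eval σ (comulRep G.comul σ σ) (G.comul a)
          (HilbTensor.assoc _ _ _ ((HilbTensor.assoc _ _ _).symm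
          (HilbTensor.tmul ζ (eval σ σ (G.comul x) (HilbTensor.tmul (σ.hom y ζ) ζ))))))
      rw [HilbTensor.assoc_tmul, LinearIsometryEquiv.apply_symm_apply, map_mul, mul_apply_eq_comp,
        eval_tmul, HilbTensor.op_tmul, map_one, one_apply_eq_self]
      rfl
    rw [e1, mul_apply_eq_comp, ← e2] at h1
    have e3 : ⟪HilbTensor.tmul (HilbTensor.tmul ζ ζ) ζ,
        HilbTensor.op (eval σ σ (G.comul b)) 1 (idTensorComul G.comul (G.comul a * tmul 1 x) σ σ σ
          (HilbTensor.tmul (HilbTensor.tmul ζ (σ.hom y ζ)) ζ))⟫_ℂ =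
        ⟪HilbTensor.tmul (star (eval σ σ (G.comul b)) (HilbTensor.tmul ζ ζ)) ζ,
          idTensorComul G.comul (G.comul a * tmul 1 x) σ σ σ
          (HilbTensor.tmul (HilbTensor.tmul ζ (σ.hom y ζ)) ζ)⟫_ℂ := by
      rw [← ContinuousLinearMap.adjoint_inner_left, ← ContinuousLinearMap.star_eq_adjoint,
        HilbTensor.star_op, HilbTensor.op_tmul, star_one, one_apply_eq_self]
    rw [e3, h2, ContinuousLinearMap.star_eq_adjoint, ContinuousLinearMap.adjoint_inner_left] at h1
    rw [map_mul, mul_apply_eq_comp, eval_tmul, HilbTensor.op_tmul, map_one,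
      one_apply_eq_self]
    exact h1
  -- Density of the span of the `Δ(b)(1 ⊗ y)` frees the left factor: `(h ⊗ h)(z(s ⊗ 1)) = 0` for
  -- every `z`.
  have key2 : ∀ a (z : MinTensor Q Q), ⟪HilbTensor.tmul ζ ζ, eval σ σ z
      (HilbTensor.tmul (σ.hom (sliceRight h (G.comul a * tmul 1 x)) ζ) ζ)⟫_ℂ = 0 := by
    intro a z
    induction z using G.induction_comul_mul_one_tmul with
    | hc => exact isClosed_eq (by fun_prop) (by fun_prop)
    | hmul b y => exact key a b y
    | h0 => simp
    | hadd z w hz hw => rw [map_add, add_apply, inner_add_right, hz, hw, add_zero]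
    | hsmul c z hz => rw [map_smul, smul_apply, inner_smul_right, hz, mul_zero]
  -- Taking `c ⊗ 1` in `key2` gives `h(cs) = 0`, that is, `(h ⊗ h)((c ⊗ 1)Δ(a)(1 ⊗ x)) = 0`; the
  -- second density condition then replaces `(c ⊗ 1)Δ(a)` by any `z`.
  have key3 : ∀ z : MinTensor Q Q, h (sliceRight h (z * tmul 1 x)) = 0 := by
    intro z
    have hcont : Continuous fun q => h q := by
      have := σ.continuous_hom
      simp_rw [← hσ]
      fun_prop
    induction z using G.induction_tmul_one_mul_comul with
    | hc => exact isClosed_eq (by fun_prop) (by fun_prop)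
    | hmul a c =>
      rw [mul_assoc, sliceRight_tmul_one_mul hh.1]
      have := key2 a (tmul c 1)
      rw [eval_tmul, HilbTensor.op_tmul, HilbTensor.inner_tmul, map_one, one_apply_eq_self,
        ← mul_apply_eq_comp, ← map_mul, hσ] at this
      refine (mul_eq_zero.mp this).resolve_right ?_
      have h1 := hσ 1
      rw [map_one, one_apply_eq_self, hh.1] at h1
      rw [h1]
      exact one_ne_zero
    | h0 => simp
    | hadd z w hz hw => rw [add_mul, map_add, map_add, hz, hw, add_zero]
    | hsmul c z hz => rw [smul_mul_assoc, map_smul, map_smul, hz, smul_zero]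
  have := key3 (tmul 1 q)
  rw [tmul_mul_tmul, sliceRight_tmul h hh.1, map_smul, mul_one, hh.1] at this
  simpa using this

end CompactQuantumGroup

/-! ### Tensor products of linear maps that respect products and adjoints -/

section TensorMaps

variable {M N A B : Type*} [Ring M] [Algebra ℂ M] [Ring N] [Algebra ℂ N]
  [Ring A] [Algebra ℂ A] [Ring B] [Algebra ℂ B]

lemma lTensor_map_mul {f : A →ₗ[ℂ] B} (hf : ∀ a b, f (a * b) = f a * f b) (X Y : M ⊗[ℂ] A) :
    f.lTensor M (X * Y) = f.lTensor M X * f.lTensor M Y := by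
  induction X using TensorProduct.induction_on with
  | zero => simp
  | add X X' hX hX' => simp only [add_mul, map_add, hX, hX']
  | tmul S a =>
    induction Y using TensorProduct.induction_on with
    | zero => simp
    | add Y Y' hY hY' => simp only [mul_add, map_add, hY, hY']
    | tmul T b => simp [hf]

lemma rTensor_map_mul {f : M →ₗ[ℂ] N} (hf : ∀ a b, f (a * b) = f a * f b) (X Y : M ⊗[ℂ] A) :
    f.rTensor A (X * Y) = f.rTensor A X * f.rTensor A Y := by
  induction X using TensorProduct.induction_on with
  | zero => simp
  | add X X' hX hX' => simp only [add_mul, map_add, hX, hX']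
  | tmul S a =>
    induction Y using TensorProduct.induction_on with
    | zero => simp
    | add Y Y' hY hY' => simp only [mul_add, map_add, hY, hY']
    | tmul T b => simp [hf]

lemma rTensor_map_one {f : M →ₗ[ℂ] N} (h1 : f 1 = 1) : f.rTensor A 1 = 1 := by
  rw [Algebra.TensorProduct.one_def, LinearMap.rTensor_tmul, h1, Algebra.TensorProduct.one_def]

variable [StarRing M] [StarModule ℂ M] [StarRing N] [StarModule ℂ N] [StarRing A] [StarModule ℂ A]
  [StarRing B] [StarModule ℂ B]

lemma star_mul_tensorProduct (X Y : M ⊗[ℂ] A) : star (X * Y) = star Y * star X := star_mul X Y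

lemma lTensor_map_star {f : A →ₗ[ℂ] B} (hf : ∀ a, f (star a) = star (f a)) (X : M ⊗[ℂ] A) :
    f.lTensor M (star X) = star (f.lTensor M X) := by
  induction X using TensorProduct.induction_on with
  | zero => simp
  | add X X' hX hX' => simp only [star_add, map_add, hX, hX']
  | tmul S a => simp [hf]

lemma rTensor_map_star {f : M →ₗ[ℂ] N} (hf : ∀ a, f (star a) = star (f a)) (X : M ⊗[ℂ] A) :
    f.rTensor A (star X) = star (f.rTensor A X) := by
  induction X using TensorProduct.induction_on with
  | zero => simp
  | add X X' hX hX' => simp only [star_add, map_add, hX, hX']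
  | tmul S a => simp [hf]

lemma rTensor_star_mul_self {f : M →ₗ[ℂ] N} (hm : ∀ a b, f (a * b) = f a * f b)
    (hs : ∀ a, f (star a) = star (f a)) (h1 : f 1 = 1) {X : M ⊗[ℂ] A} (hX : star X * X = 1) :
    star (f.rTensor A X) * f.rTensor A X = 1 := by
  rw [← rTensor_map_star hs, ← rTensor_map_mul hm, hX, rTensor_map_one h1]

lemma rTensor_mul_star_self_eq {f : M →ₗ[ℂ] N} (hm : ∀ a b, f (a * b) = f a * f b)
    (hs : ∀ a, f (star a) = star (f a)) (X : M ⊗[ℂ] A) :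
    f.rTensor A (X * star X) = f.rTensor A X * star (f.rTensor A X) := by
  rw [rTensor_map_mul hm, rTensor_map_star hs]

end TensorMaps

/-! ### Legs -/

section Legs

variable {Q : Type u} [CStarAlgebra Q]
  {K : Type v} [NormedAddCommGroup K] [InnerProductSpace ℂ K]

lemma tmul_mul_tmul_minTensor (S T : K →L[ℂ] K) (x y : MinTensor Q Q) :
    S ⊗ₜ[ℂ] x * T ⊗ₜ[ℂ] y = (S * T) ⊗ₜ[ℂ] (x * y) :=
  Algebra.TensorProduct.tmul_mul_tmul S T x y

@[simp] lemma leg₁₂_tmul (S : K →L[ℂ] K) (a : Q) :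
    leg₁₂ (S ⊗ₜ[ℂ] a) = S ⊗ₜ[ℂ] MinTensor.tmul a 1 := rfl

@[simp] lemma leg₁₃_tmul (S : K →L[ℂ] K) (a : Q) :
    leg₁₃ (S ⊗ₜ[ℂ] a) = S ⊗ₜ[ℂ] MinTensor.tmul 1 a := rfl

lemma leg₁₂_mul (X Y : (K →L[ℂ] K) ⊗[ℂ] Q) : leg₁₂ (X * Y) = leg₁₂ X * leg₁₂ Y :=
  lTensor_map_mul (fun a b => by
    change MinTensor.tmul (a * b) 1 = MinTensor.tmul a 1 * MinTensor.tmul b 1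
    rw [MinTensor.tmul_mul_tmul, one_mul]) X Y

lemma leg₁₃_mul (X Y : (K →L[ℂ] K) ⊗[ℂ] Q) : leg₁₃ (X * Y) = leg₁₃ X * leg₁₃ Y :=
  lTensor_map_mul (fun a b => by
    change MinTensor.tmul 1 (a * b) = MinTensor.tmul 1 a * MinTensor.tmul 1 b
    rw [MinTensor.tmul_mul_tmul, one_mul]) X Y

variable {L : Type v} [NormedAddCommGroup L] [InnerProductSpace ℂ L]

lemma leg₁₂_rTensor (f : (K →L[ℂ] K) →ₗ[ℂ] (L →L[ℂ] L)) (X : (K →L[ℂ] K) ⊗[ℂ] Q) :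
    leg₁₂ (f.rTensor Q X) = f.rTensor (MinTensor Q Q) (leg₁₂ X) := by
  rw [leg₁₂, leg₁₂, ← LinearMap.comp_apply, ← LinearMap.comp_apply, LinearMap.lTensor_comp_rTensor,
    LinearMap.rTensor_comp_lTensor]

lemma leg₁₃_rTensor (f : (K →L[ℂ] K) →ₗ[ℂ] (L →L[ℂ] L)) (X : (K →L[ℂ] K) ⊗[ℂ] Q) :
    leg₁₃ (f.rTensor Q X) = f.rTensor (MinTensor Q Q) (leg₁₃ X) := by
  rw [leg₁₃, leg₁₃, ← LinearMap.comp_apply, ← LinearMap.comp_apply, LinearMap.lTensor_comp_rTensor,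
    LinearMap.rTensor_comp_lTensor]

lemma rTensor_minTensor_mul {f : (K →L[ℂ] K) →ₗ[ℂ] (L →L[ℂ] L)}
    (hf : ∀ S T, f (S * T) = f S * f T) (X Y : (K →L[ℂ] K) ⊗[ℂ] MinTensor Q Q) :
    f.rTensor (MinTensor Q Q) (X * Y) =
      f.rTensor (MinTensor Q Q) X * f.rTensor (MinTensor Q Q) Y :=
  rTensor_map_mul hf X Y

/-- Corepresentation identities are transported along multiplicative maps. -/
lemma lTensor_rTensor_eq_leg_mul_leg {f : (K →L[ℂ] K) →ₗ[ℂ] (L →L[ℂ] L)}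
    (hf : ∀ S T, f (S * T) = f S * f T) {g : Q →ₗ[ℂ] MinTensor Q Q} {X : (K →L[ℂ] K) ⊗[ℂ] Q}
    (hX : g.lTensor _ X = leg₁₂ X * leg₁₃ X) :
    g.lTensor _ (f.rTensor Q X) = leg₁₂ (f.rTensor Q X) * leg₁₃ (f.rTensor Q X) := by
  rw [leg₁₂_rTensor, leg₁₃_rTensor, ← rTensor_minTensor_mul hf, ← hX, ← LinearMap.comp_apply,
    ← LinearMap.comp_apply, LinearMap.lTensor_comp_rTensor, LinearMap.rTensor_comp_lTensor]

variable [CompleteSpace K]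

lemma star_mul_minTensor (X Y : (K →L[ℂ] K) ⊗[ℂ] MinTensor Q Q) :
    star (X * Y) = star Y * star X := star_mul_tensorProduct X Y

lemma star_leg₁₂ (X : (K →L[ℂ] K) ⊗[ℂ] Q) : star (leg₁₂ X) = leg₁₂ (star X) :=
  (lTensor_map_star (fun a => by
    change MinTensor.tmul (star a) 1 = star (MinTensor.tmul a 1)
    rw [MinTensor.star_tmul, star_one]) X).symm

lemma star_leg₁₃ (X : (K →L[ℂ] K) ⊗[ℂ] Q) : star (leg₁₃ X) = leg₁₃ (star X) :=
  (lTensor_map_star (fun a => by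
    change MinTensor.tmul 1 (star a) = star (MinTensor.tmul 1 a)
    rw [MinTensor.star_tmul, star_one]) X).symm

end Legs

namespace CompactQuantumGroup

variable {Q : Type u} [CStarAlgebra Q] {G : CompactQuantumGroup Q}
  {K : Type v} [NormedAddCommGroup K] [InnerProductSpace ℂ K]

lemma lTensor_comul_mul (X Y : (K →L[ℂ] K) ⊗[ℂ] Q) :
    G.comul.toAlgHom.toLinearMap.lTensor _ (X * Y) =
      G.comul.toAlgHom.toLinearMap.lTensor _ X * G.comul.toAlgHom.toLinearMap.lTensor _ Y :=
  lTensor_map_mul (fun a b => map_mul G.comul a b) X Y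

lemma lTensor_comul_star [CompleteSpace K] (X : (K →L[ℂ] K) ⊗[ℂ] Q) :
    G.comul.toAlgHom.toLinearMap.lTensor _ (star X) =
      star (G.comul.toAlgHom.toLinearMap.lTensor _ X) :=
  lTensor_map_star (fun a => map_star G.comul a) X

end CompactQuantumGroup

/-! ### Slicing by a functional -/

section Slice

variable {Q : Type u} [CStarAlgebra Q] [PartialOrder Q]

/-- The slice map `id ⊗ h : M ⊗ Q → M` on an algebraic tensor product. -/
noncomputable def sliceFunctional (M : Type*) [AddCommGroup M] [Module ℂ M] (h : Q →ₚ[ℂ] ℂ) :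
    M ⊗[ℂ] Q →ₗ[ℂ] M :=
  (TensorProduct.rid ℂ M).toLinearMap ∘ₗ h.toLinearMap.lTensor M

@[simp] lemma sliceFunctional_tmul {M : Type*} [AddCommGroup M] [Module ℂ M] (h : Q →ₚ[ℂ] ℂ)
    (m : M) (a : Q) : sliceFunctional M h (m ⊗ₜ a) = h a • m := rfl

section

variable {M : Type*} [Ring M] [Algebra ℂ M] (h : Q →ₚ[ℂ] ℂ)

lemma sliceFunctional_tmul_one_mul (m : M) (X : M ⊗[ℂ] Q) :
    sliceFunctional M h (m ⊗ₜ 1 * X) = m * sliceFunctional M h X := by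
  induction X using TensorProduct.induction_on with
  | zero => simp
  | add X X' hX hX' => simp only [mul_add, map_add, hX, hX']
  | tmul S a => simp

lemma sliceFunctional_mul_tmul_one (m : M) (X : M ⊗[ℂ] Q) :
    sliceFunctional M h (X * m ⊗ₜ 1) = sliceFunctional M h X * m := by
  induction X using TensorProduct.induction_on with
  | zero => simp
  | add X X' hX hX' => simp only [add_mul, map_add, hX, hX']
  | tmul S a => simp

lemma star_sliceFunctional [StarOrderedRing Q] [StarRing M] [StarModule ℂ M] (X : M ⊗[ℂ] Q) :
    star (sliceFunctional M h X) = sliceFunctional M h (star X) := by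
  induction X using TensorProduct.induction_on with
  | zero => simp
  | add X X' hX hX' => simp only [star_add, map_add, hX, hX']
  | tmul S a => simp [map_star h a]

end

variable {h : Q →ₚ[ℂ] ℂ} {K : Type v} [NormedAddCommGroup K] [InnerProductSpace ℂ K]

/-- The outer factors do not touch the third leg, so `id ⊗ id ⊗ h` acts only on the middle factor.
With `A = Y`, `C = YY*`, `B = Y*` this computes the Haar average of `YY*` for a corepresentation
`Y`. -/
lemma lTensor_sliceRight_leg_mul [StarOrderedRing Q] [CompleteSpace K] (h1 : h 1 = 1)
    (A B C : (K →L[ℂ] K) ⊗[ℂ] Q) :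
    (MinTensor.sliceRight h).toLinearMap.lTensor _ (leg₁₂ A * leg₁₃ C * leg₁₂ B) =
      A * (sliceFunctional _ h C ⊗ₜ 1) * B := by
  induction A using TensorProduct.induction_on with
  | zero => simp
  | add X X' hX hX' => simp only [add_mul, map_add, hX, hX']
  | tmul S a =>
    induction C using TensorProduct.induction_on with
    | zero => simp
    | add X X' hX hX' => simp only [add_mul, mul_add, map_add, hX, hX', TensorProduct.add_tmul]
    | tmul T c =>
      induction B using TensorProduct.induction_on with
      | zero => simp
      | add X X' hX hX' => simp only [mul_add, map_add, hX, hX']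
      | tmul W b =>
        rw [leg₁₂_tmul, leg₁₃_tmul, leg₁₂_tmul, tmul_mul_tmul_minTensor, tmul_mul_tmul_minTensor,
          MinTensor.tmul_mul_tmul, MinTensor.tmul_mul_tmul, LinearMap.lTensor_tmul]
        simp [MinTensor.sliceRight_tmul h h1, TensorProduct.smul_tmul']

/-- The mirror image, slicing the second leg; it serves `V*V` for a left projective corepresentation
`V`. -/
lemma lTensor_sliceLeft_leg_mul [StarOrderedRing Q] [CompleteSpace K] (h1 : h 1 = 1)
    (A B C : (K →L[ℂ] K) ⊗[ℂ] Q) :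
    (MinTensor.sliceLeft h).toLinearMap.lTensor _ (leg₁₃ A * leg₁₂ C * leg₁₃ B) =
      A * (sliceFunctional _ h C ⊗ₜ 1) * B := by
  induction A using TensorProduct.induction_on with
  | zero => simp
  | add X X' hX hX' => simp only [add_mul, map_add, hX, hX']
  | tmul S a =>
    induction C using TensorProduct.induction_on with
    | zero => simp
    | add X X' hX hX' => simp only [add_mul, mul_add, map_add, hX, hX', TensorProduct.add_tmul]
    | tmul T c =>
      induction B using TensorProduct.induction_on with
      | zero => simp
      | add X X' hX hX' => simp only [mul_add, map_add, hX, hX']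
      | tmul W b =>
        rw [leg₁₂_tmul, leg₁₃_tmul, leg₁₃_tmul, tmul_mul_tmul_minTensor, tmul_mul_tmul_minTensor,
          MinTensor.tmul_mul_tmul, MinTensor.tmul_mul_tmul, LinearMap.lTensor_tmul]
        simp [MinTensor.sliceLeft_tmul h h1, TensorProduct.smul_tmul']

namespace CompactQuantumGroup

variable {G : CompactQuantumGroup Q}

lemma IsHaarState.lTensor_sliceRight_comul (hh : G.IsHaarState h) (X : (K →L[ℂ] K) ⊗[ℂ] Q) :
    (MinTensor.sliceRight h).toLinearMap.lTensor _
      (G.comul.toAlgHom.toLinearMap.lTensor _ X) = sliceFunctional _ h X ⊗ₜ 1 := by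
  induction X using TensorProduct.induction_on with
  | zero => simp
  | add X X' hX hX' => simp only [map_add, hX, hX', TensorProduct.add_tmul]
  | tmul S a =>
    change S ⊗ₜ MinTensor.sliceRight h (G.comul a) = _
    rw [(hh.2 a).1, sliceFunctional_tmul, TensorProduct.smul_tmul]

lemma IsHaarState.lTensor_sliceLeft_comul (hh : G.IsHaarState h) (X : (K →L[ℂ] K) ⊗[ℂ] Q) :
    (MinTensor.sliceLeft h).toLinearMap.lTensor _
      (G.comul.toAlgHom.toLinearMap.lTensor _ X) = sliceFunctional _ h X ⊗ₜ 1 := by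
  induction X using TensorProduct.induction_on with
  | zero => simp
  | add X X' hX hX' => simp only [map_add, hX, hX', TensorProduct.add_tmul]
  | tmul S a =>
    change S ⊗ₜ MinTensor.sliceLeft h (G.comul a) = _
    rw [(hh.2 a).2, sliceFunctional_tmul, TensorProduct.smul_tmul]

/-- `h(x x*) = 0` implies `h(x* x) = 0`. -/
lemma IsHaarState.map_star_mul_self_eq_zero [StarOrderedRing Q] (hh : G.IsHaarState h) {x : Q}
    (hx : h (x * star x) = 0) : h (star x * x) = 0 := by
  refine hh.map_mul_eq_zero_of_forall (fun b => ?_) _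
  obtain ⟨σ, ζ, -, hσ⟩ := exists_rep_vector h hh.1
  -- By this formula `h(xx*)` is the squared norm of `σ(x*)ζ`; once that vector is zero, `h(xb) = 0`
  -- for all `b`.
  have e : ∀ c, h (x * c) = ⟪σ.hom (star x) ζ, σ.hom c ζ⟫_ℂ := fun c => by
    rw [← hσ, map_mul, mul_apply_eq_comp, map_star, ContinuousLinearMap.star_eq_adjoint,
      ContinuousLinearMap.adjoint_inner_left]
  rw [e, inner_self_eq_zero] at hx
  rw [e, hx, inner_zero_left]

end CompactQuantumGroup

end Slice

/-! ### The trace -/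

section Trace

open InnerProductSpace

variable {Q : Type u} [CStarAlgebra Q]
  {L : Type v} [NormedAddCommGroup L] [InnerProductSpace ℂ L]

lemma opTrace_mul_comm (S T : L →L[ℂ] L) : opTrace L (S * T) = opTrace L (T * S) :=
  LinearMap.trace_mul_comm ℂ S.toLinearMap T.toLinearMap

variable [FiniteDimensional ℂ L]

lemma opTrace_rankOne (x y : L) : opTrace L (rankOne ℂ x y) = ⟪y, x⟫_ℂ := trace_rankOne x y

lemma exists_eq_sum_rankOne_tmul (X : (L →L[ℂ] L) ⊗[ℂ] Q) :
    ∃ z : Fin (Module.finrank ℂ L) → Fin (Module.finrank ℂ L) → Q,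
      X = ∑ i, ∑ j, rankOne ℂ (stdOrthonormalBasis ℂ L i) (stdOrthonormalBasis ℂ L j) ⊗ₜ z i j := by
  induction X using TensorProduct.induction_on with
  | zero => exact ⟨0, by simp⟩
  | add X X' hX hX' =>
    obtain ⟨z, rfl⟩ := hX
    obtain ⟨z', rfl⟩ := hX'
    exact ⟨z + z', by simp [TensorProduct.tmul_add, Finset.sum_add_distrib]⟩
  | tmul S a =>
    let b := stdOrthonormalBasis ℂ L
    refine ⟨fun i j => ⟪b i, S (b j)⟫_ℂ • a, ?_⟩
    have : S = ∑ i, ∑ j, ⟪b i, S (b j)⟫_ℂ • rankOne ℂ (b i) (b j) := by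
      refine ContinuousLinearMap.coe_injective (b.toBasis.ext fun k => ?_)
      simp only [OrthonormalBasis.coe_toBasis, ContinuousLinearMap.coe_coe, sum_apply,
        smul_apply, rankOne_apply, orthonormal_iff_ite.mp b.orthonormal]
      simp [b.sum_repr']
    conv_lhs => rw [this]
    simp only [TensorProduct.sum_tmul, TensorProduct.smul_tmul]
    rfl

variable [CompleteSpace L]

lemma eq_zero_of_opTrace_star_mul_self {T : L →L[ℂ] L}
    (hT : opTrace L (star T * T) = 0) : T = 0 := by
  let b := stdOrthonormalBasis ℂ L
  have h1 : opTrace L (star T * T) = ∑ i, ⟪T (b i), T (b i)⟫_ℂ := by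
    change LinearMap.trace ℂ L _ = _
    rw [LinearMap.trace_eq_sum_inner _ b]
    refine Finset.sum_congr rfl fun i _ => ?_
    change ⟪b i, star T (T (b i))⟫_ℂ = _
    rw [ContinuousLinearMap.star_eq_adjoint, ContinuousLinearMap.adjoint_inner_right]
  rw [h1, Finset.sum_eq_zero_iff_of_nonneg fun i _ => by
    rw [inner_self_eq_norm_sq_to_K]; positivity] at hT
  refine ContinuousLinearMap.coe_injective (b.toBasis.ext fun k => ?_)
  simpa using hT k (Finset.mem_univ k)

variable [PartialOrder Q]

/-- In matrix units a diagonal entry of `X*X` is a column sum of `z* z`, and one of `XX*` a row sum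
of `z z*`. Statements about `h` thus pass entry by entry to `Tr ⊗ h`. -/
lemma opTrace_sliceFunctional_star_mul_self (h : Q →ₚ[ℂ] ℂ)
    (z : Fin (Module.finrank ℂ L) → Fin (Module.finrank ℂ L) → Q) {X : (L →L[ℂ] L) ⊗[ℂ] Q}
    (hX : X =
      ∑ i, ∑ j, rankOne ℂ (stdOrthonormalBasis ℂ L i) (stdOrthonormalBasis ℂ L j) ⊗ₜ z i j) :
    opTrace L (sliceFunctional _ h (star X * X)) = ∑ i, ∑ j, h (star (z i j) * z i j) ∧
    opTrace L (sliceFunctional _ h (X * star X)) = ∑ i, ∑ j, h (z i j * star (z i j)) := by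
  have hb := orthonormal_iff_ite.mp (stdOrthonormalBasis ℂ L).orthonormal
  have hmul : ∀ x y x' y' : L, rankOne ℂ x y * rankOne ℂ x' y' = ⟪y, x'⟫_ℂ • rankOne ℂ x y' :=
    fun x y x' y' => rankOne_comp_rankOne x y x' y'
  constructor
  · simp only [hX, star_sum, TensorProduct.star_tmul, ContinuousLinearMap.star_eq_adjoint,
      adjoint_rankOne, Finset.sum_mul, Finset.mul_sum, Algebra.TensorProduct.tmul_mul_tmul, hmul,
      map_sum, sliceFunctional_tmul, map_smul, opTrace_rankOne, hb]
    simp [Finset.sum_ite_eq]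
  · simp only [hX, star_sum, TensorProduct.star_tmul, ContinuousLinearMap.star_eq_adjoint,
      adjoint_rankOne, Finset.sum_mul, Finset.mul_sum, Algebra.TensorProduct.tmul_mul_tmul, hmul,
      map_sum, sliceFunctional_tmul, map_smul, opTrace_rankOne, hb]
    simp [Finset.sum_ite_eq]

lemma opTrace_sliceFunctional_mul_star_nonneg [StarOrderedRing Q] (h : Q →ₚ[ℂ] ℂ)
    (X : (L →L[ℂ] L) ⊗[ℂ] Q) :
    0 ≤ opTrace L (sliceFunctional _ h (X * star X)) := by
  obtain ⟨z, hz⟩ := exists_eq_sum_rankOne_tmul X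
  rw [(opTrace_sliceFunctional_star_mul_self h z hz).2]
  exact Finset.sum_nonneg fun i _ => Finset.sum_nonneg fun j _ =>
    h.map_nonneg (mul_star_self_nonneg _)

/-- A vanishing sum of nonnegative terms `h(z z*)` has all terms zero, and each can be flipped to
`h(z* z)` separately. -/
lemma CompactQuantumGroup.IsHaarState.opTrace_star_mul_self_eq_zero [StarOrderedRing Q]
    {G : CompactQuantumGroup Q}
    {h : Q →ₚ[ℂ] ℂ} (hh : G.IsHaarState h) {X : (L →L[ℂ] L) ⊗[ℂ] Q}
    (hX : opTrace L (sliceFunctional _ h (X * star X)) = 0) :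
    opTrace L (sliceFunctional _ h (star X * X)) = 0 := by
  obtain ⟨z, hz⟩ := exists_eq_sum_rankOne_tmul X
  have hnn : ∀ i j, 0 ≤ h (z i j * star (z i j)) := fun i j =>
    h.map_nonneg (mul_star_self_nonneg _)
  rw [(opTrace_sliceFunctional_star_mul_self h z hz).2,
    Finset.sum_eq_zero_iff_of_nonneg fun i _ => Finset.sum_nonneg fun j _ => hnn i j] at hX
  rw [(opTrace_sliceFunctional_star_mul_self h z hz).1]
  refine Finset.sum_eq_zero fun i hi => Finset.sum_eq_zero fun j hj => ?_
  have := (Finset.sum_eq_zero_iff_of_nonneg fun j _ => hnn i j).mp (hX i hi) j hj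
  exact hh.map_star_mul_self_eq_zero this

end Trace

/-! ### Isometric corepresentations are unitary -/

section Isometric

/-- Since `1 - p` equals both `TP` and `PT`, moving `P` past `Y` gives `(1 - p)Yp = TYPp = 0` and
`pY(1 - p) = pPYT = 0`. So commutation with `P` passes to its kernel projection by algebra alone. -/
lemma mul_eq_mul_of_mul_eq_one_sub {A : Type*} [Ring A] {Y P p T : A} (hY : Y * P = P * Y)
    (h1 : P * p = 0) (h2 : p * P = 0) (h3 : T * P = 1 - p) (h4 : P * T = 1 - p) :
    p * Y = Y * p := by
  have e1 : (1 - p) * Y * p = 0 := by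
    rw [← h3, mul_assoc T, ← hY, mul_assoc, mul_assoc, h1, mul_zero, mul_zero]
  have e2 : p * Y * (1 - p) = 0 := by
    rw [← h4, mul_assoc, ← mul_assoc Y, hY, ← mul_assoc, ← mul_assoc, h2, zero_mul, zero_mul]
  rw [sub_mul, sub_mul, one_mul, sub_eq_zero] at e1
  rw [mul_sub, mul_one, sub_eq_zero] at e2
  rw [e2, e1]

variable {L : Type v} [NormedAddCommGroup L] [InnerProductSpace ℂ L] [CompleteSpace L]
  [FiniteDimensional ℂ L]

/-- A self-adjoint operator on a finite-dimensional space is invertible up to the projection onto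
its kernel. -/
lemma exists_projection_of_isSelfAdjoint {P : L →L[ℂ] L} (hP : star P = P) :
    ∃ p T : L →L[ℂ] L, star p = p ∧ p * p = p ∧ P * p = 0 ∧ p * P = 0 ∧
      T * P = 1 - p ∧ P * T = 1 - p := by
  let p : L →L[ℂ] L := (LinearMap.ker P.toLinearMap).starProjection
  have hp : IsStarProjection p := isStarProjection_starProjection
  have hPp : P * p = 0 := by
    ext x
    have : p x ∈ LinearMap.ker P.toLinearMap := Submodule.starProjection_apply_mem _ x
    exact this
  have hpP : p * P = 0 := by
    have := congrArg star hPp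
    rwa [star_mul, hP, hp.isSelfAdjoint.star_eq, star_zero] at this
  -- In finite dimension this makes `P + p` invertible. Its inverse serves as `T`, because it fixes
  -- `p` under multiplication from either side.
  have hinj : Function.Injective (P + p) := by
    rw [injective_iff_map_eq_zero]
    intro x hx
    have h1 : p x = 0 := by
      have : (p * (P + p)) x = 0 := by rw [mul_apply_eq_comp, hx, map_zero]
      rwa [mul_add, hpP, zero_add, hp.isIdempotentElem.eq] at this
    have h2 : x ∈ LinearMap.ker P.toLinearMap := by
      rw [add_apply, h1, add_zero] at hx
      exact hx
    rw [← h1]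
    exact ((Submodule.starProjection_eq_self_iff).mpr h2).symm
  have hunit : IsUnit (P + p) := by
    rw [ContinuousLinearMap.isUnit_iff_bijective]
    exact ⟨hinj, (LinearMap.injective_iff_surjective (f := (P + p).toLinearMap)).mp hinj⟩
  obtain ⟨⟨_, T, hT, hT'⟩, rfl⟩ := hunit
  have hTp : T * p = p := by
    have : T * (P + p) * p = p := by rw [hT', one_mul]
    rwa [mul_assoc, add_mul, hPp, zero_add, hp.isIdempotentElem.eq] at this
  have hpT : p * T = p := by
    have : p * ((P + p) * T) = p := by rw [hT, mul_one]
    rwa [← mul_assoc, mul_add, hpP, zero_add, hp.isIdempotentElem.eq] at this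
  refine ⟨p, T, hp.isSelfAdjoint.star_eq, hp.isIdempotentElem.eq, hPp, hpP, ?_, ?_⟩
  · rw [← hT', mul_add, hTp, add_sub_cancel_right]
  · rw [← hT, add_mul, hpT, add_sub_cancel_right]

variable {Q : Type u} [CStarAlgebra Q] [PartialOrder Q] [StarOrderedRing Q]

/-- The Haar average `P` of the range projection `YY*` is intertwined by `Y`. On the kernel of `P`
the range projection has zero Haar trace while `Y` is still isometric there, so that kernel is zero
and `P` supplies a right inverse of `Y`. -/
theorem CompactQuantumGroup.IsHaarState.mem_unitary_of_star_mul_self {G : CompactQuantumGroup Q}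
    {h : Q →ₚ[ℂ] ℂ} (hh : G.IsHaarState h) {Y : (L →L[ℂ] L) ⊗[ℂ] Q} (hY : star Y * Y = 1)
    (hc : G.comul.toAlgHom.toLinearMap.lTensor _ Y = leg₁₂ Y * leg₁₃ Y) :
    Y ∈ unitary ((L →L[ℂ] L) ⊗[ℂ] Q) := by
  set P := sliceFunctional _ h (Y * star Y) with hPdef
  -- Apply `id ⊗ id ⊗ h` to `(id ⊗ Δ)(YY*) = Y₁₂ (YY*)₁₃ Y₁₂*`.
  have h1 : Y * (P ⊗ₜ 1) * star Y = P ⊗ₜ 1 := by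
    rw [hPdef, ← lTensor_sliceRight_leg_mul hh.1, ← hh.lTensor_sliceRight_comul,
      lTensor_comul_mul, lTensor_comul_star, hc, star_mul_minTensor, leg₁₃_mul, star_leg₁₂,
      star_leg₁₃]
    simp only [mul_assoc]
  have hPs : star P = P := by rw [hPdef, star_sliceFunctional, star_mul, star_star]
  have hcomm : Y * (P ⊗ₜ 1) = (P ⊗ₜ 1) * Y := by
    rw [← h1, mul_assoc _ (star Y), hY, mul_one, h1]
  obtain ⟨p, T, hps, hpp, hPp, hpP, hTP, hPT⟩ := exists_projection_of_isSelfAdjoint hPs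
  have hι : ∀ S S' : L →L[ℂ] L, (S ⊗ₜ[ℂ] (1 : Q)) * (S' ⊗ₜ 1) = (S * S') ⊗ₜ 1 := by simp
  have h1p : ((1 : L →L[ℂ] L) - p) ⊗ₜ[ℂ] (1 : Q) = 1 - p ⊗ₜ 1 := by
    rw [TensorProduct.sub_tmul, Algebra.TensorProduct.one_def]
  have hpY : (p ⊗ₜ 1) * Y = Y * (p ⊗ₜ 1) := mul_eq_mul_of_mul_eq_one_sub
    (P := P ⊗ₜ[ℂ] (1 : Q)) (p := p ⊗ₜ[ℂ] (1 : Q)) (T := T ⊗ₜ[ℂ] (1 : Q)) hcomm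
    (by rw [hι, hPp, TensorProduct.zero_tmul]) (by rw [hι, hpP, TensorProduct.zero_tmul])
    (by rw [hι T, hTP, h1p]) (by rw [hι, hPT, h1p])
  have hps' : star (p ⊗ₜ[ℂ] (1 : Q)) = p ⊗ₜ 1 := by rw [TensorProduct.star_tmul, hps, star_one]
  have hp0 : p = 0 := by
    apply eq_zero_of_opTrace_star_mul_self
    -- The slice of `(pY)(pY)*` is `pPp = 0`. After the flip, `pY = Yp` turns `(pY)*(pY)` into `p`,
    -- whose trace must therefore vanish.
    have h2 : opTrace L (sliceFunctional _ h ((p ⊗ₜ 1 * Y) * star (p ⊗ₜ 1 * Y))) = 0 := by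
      rw [star_mul, hps', mul_assoc, ← mul_assoc Y, sliceFunctional_tmul_one_mul,
        sliceFunctional_mul_tmul_one, ← hPdef, hPp, mul_zero, map_zero]
    have h3 := hh.opTrace_star_mul_self_eq_zero h2
    rw [hpY, star_mul, mul_assoc, ← mul_assoc (star Y), hY, one_mul, hps', hι,
      sliceFunctional_tmul, hh.1, one_smul] at h3
    rwa [hps]
  rw [hp0, sub_zero] at hPT
  have hr : Y * ((P ⊗ₜ 1) * star Y * (T ⊗ₜ 1)) = 1 := by
    rw [← mul_assoc, ← mul_assoc, h1, hι, hPT, Algebra.TensorProduct.one_def]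
  refine Unitary.mem_iff.mpr ⟨hY, ?_⟩
  have : star Y = (P ⊗ₜ 1) * star Y * (T ⊗ₜ 1) :=
    left_inv_eq_right_inv (M := (L →L[ℂ] L) ⊗[ℂ] Q) hY hr
  rw [this, hr]

end Isometric

/-! ### Tensor products of projective corepresentations -/

lemma star_mul_self_mul_eq_one {A : Type*} [Monoid A] [StarMul A] {a b : A}
    (ha : star a * a = 1) (hb : star b * b = 1) : star (a * b) * (a * b) = 1 := by
  rw [star_mul, mul_assoc, ← mul_assoc (star a), ha, one_mul, hb]

/-- An isometric left factor can be cancelled from a coisometric product, which is how unitarity of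
`U₁₃V₂₃` descends to `V`. -/
lemma mul_star_self_right_eq_one {A : Type*} [Monoid A] [StarMul A] {a b : A}
    (ha : star a * a = 1) (hab : a * b * star (a * b) = 1) : b * star b = 1 := by
  calc b * star b = star a * a * (b * star b) * (star a * a) := by rw [ha, one_mul, mul_one]
    _ = star a * (a * b * star (a * b)) * a := by simp only [star_mul, mul_assoc]
    _ = 1 := by rw [hab, mul_one, ha]

section CorepTensor

variable {Q : Type u} [CStarAlgebra Q] {G : CompactQuantumGroup Q}
  {K L : Type v} [NormedAddCommGroup K] [InnerProductSpace ℂ K]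
  [NormedAddCommGroup L] [InnerProductSpace ℂ L]

namespace CompactQuantumGroup

lemma lTensor_comulRight [CompleteSpace K] (Ω : MinTensor Q Q) (X : (K →L[ℂ] K) ⊗[ℂ] Q) :
    (G.comulRight Ω).lTensor _ X = G.comul.toAlgHom.toLinearMap.lTensor _ X * (1 ⊗ₜ Ω) := by
  induction X using TensorProduct.induction_on with
  | zero => simp
  | add X X' hX hX' => simp only [map_add, hX, hX', add_mul]
  | tmul S a =>
    rw [LinearMap.lTensor_tmul, LinearMap.lTensor_tmul, tmul_mul_tmul_minTensor, mul_one]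
    rfl

lemma lTensor_comulLeft [CompleteSpace K] (Ω : MinTensor Q Q) (X : (K →L[ℂ] K) ⊗[ℂ] Q) :
    (G.comulLeft Ω).lTensor _ X = (1 ⊗ₜ Ω) * G.comul.toAlgHom.toLinearMap.lTensor _ X := by
  induction X using TensorProduct.induction_on with
  | zero => simp
  | add X X' hX hX' => simp only [map_add, hX, hX', mul_add]
  | tmul S a =>
    rw [LinearMap.lTensor_tmul, LinearMap.lTensor_tmul, tmul_mul_tmul_minTensor, one_mul]
    rfl

end CompactQuantumGroup

lemma one_tmul_mul_one_tmul_minTensor (x y : MinTensor Q Q) :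
    (1 : K →L[ℂ] K) ⊗ₜ[ℂ] x * (1 : K →L[ℂ] K) ⊗ₜ[ℂ] y = 1 ⊗ₜ (x * y) := by
  rw [tmul_mul_tmul_minTensor, one_mul]

lemma one_tmul_one_minTensor :
    (1 : K →L[ℂ] K) ⊗ₜ[ℂ] (1 : MinTensor Q Q) = 1 := Algebra.TensorProduct.one_def.symm

namespace HilbTensor

lemma opₗ_flip_one_mul (S T : K →L[ℂ] K) :
    (opₗ K L).flip 1 (S * T) = (opₗ K L).flip 1 S * (opₗ K L).flip 1 T := by
  change op (S * T) 1 = op S 1 * op T 1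
  rw [← op_mul, one_mul]

lemma opₗ_one_mul (S T : L →L[ℂ] L) :
    opₗ K L 1 (S * T) = opₗ K L 1 S * opₗ K L 1 T := by
  change op 1 (S * T) = op 1 S * op 1 T
  rw [← op_mul, one_mul]

variable [CompleteSpace K] [CompleteSpace L] in
lemma opₗ_flip_one_star (S : K →L[ℂ] K) :
    (opₗ K L).flip 1 (star S) = star ((opₗ K L).flip 1 S) := by
  change op (star S) 1 = star (op S 1)
  rw [star_op, star_one]

variable [CompleteSpace K] [CompleteSpace L] in
lemma opₗ_one_star (S : L →L[ℂ] L) : opₗ K L 1 (star S) = star (opₗ K L 1 S) := by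
  change op 1 (star S) = star (op 1 S)
  rw [star_op, star_one]

lemma opₗ_one_injective [Nontrivial K] : Function.Injective (opₗ K L 1) := by
  rw [injective_iff_map_eq_zero]
  intro T hT
  obtain ⟨x, hx⟩ := exists_ne (0 : K)
  ext y
  have : op 1 T (tmul x y) = 0 := by
    change opₗ K L 1 T _ = 0
    rw [hT, zero_apply]
  rw [op_tmul, ← norm_eq_zero, norm_tmul, one_apply_eq_self, mul_eq_zero, norm_eq_zero,
    norm_eq_zero] at this
  simpa [hx] using this

/-- The dense image of the algebraic tensor product is finite-dimensional, hence closed, so the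
completion adds nothing. The unitarity theorem thereby applies on `H ⊗ H̄_R`. -/
instance [FiniteDimensional ℂ K] [FiniteDimensional ℂ L] :
    FiniteDimensional ℂ (HilbTensor K L) := by
  have hr : Function.Surjective (incl K L) := by
    have : IsClosed (LinearMap.range (incl K L).toLinearMap : Set (HilbTensor K L)) :=
      Submodule.closed_of_finiteDimensional _
    intro z
    have hz : z ∈ closure (Set.range (incl K L)) := denseRange_incl z
    have := closure_minimal (s := Set.range (incl K L)) (by rintro _ ⟨x, rfl⟩; exact ⟨x, rfl⟩)
      this hz
    exact this
  exact Module.Finite.of_surjective (incl K L).toLinearMap hr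

end HilbTensor

/-- The factors occupy disjoint legs: `X` lives in `K` and the second copy of `Q`, `Y` in `L` and
the first. -/
lemma rTensor_op_mul_comm (X : (K →L[ℂ] K) ⊗[ℂ] Q) (Y : (L →L[ℂ] L) ⊗[ℂ] Q) :
    ((HilbTensor.opₗ K L).flip 1).rTensor _ (leg₁₃ X) * (HilbTensor.opₗ K L 1).rTensor _ (leg₁₂ Y) =
      (HilbTensor.opₗ K L 1).rTensor _ (leg₁₂ Y) *
        ((HilbTensor.opₗ K L).flip 1).rTensor _ (leg₁₃ X) := by
  induction X using TensorProduct.induction_on with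
  | zero => simp
  | add X X' hX hX' => simp only [map_add, add_mul, mul_add, hX, hX']
  | tmul S a =>
    induction Y using TensorProduct.induction_on with
    | zero => simp
    | add Y Y' hY hY' => simp only [map_add, add_mul, mul_add, hY, hY']
    | tmul T b =>
      rw [leg₁₂_tmul, leg₁₃_tmul, LinearMap.rTensor_tmul, LinearMap.rTensor_tmul,
        tmul_mul_tmul_minTensor, tmul_mul_tmul_minTensor, MinTensor.tmul_mul_tmul,
        MinTensor.tmul_mul_tmul, one_mul, mul_one, one_mul, mul_one]
      congr 1
      change HilbTensor.op S 1 * HilbTensor.op 1 T = HilbTensor.op 1 T * HilbTensor.op S 1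
      rw [← HilbTensor.op_mul, ← HilbTensor.op_mul, one_mul, mul_one, one_mul, mul_one]

variable [CompleteSpace K] [CompleteSpace L]

section

variable {E : Type v} [NormedAddCommGroup E] [InnerProductSpace ℂ E] [CompleteSpace E]
  {f : (K →L[ℂ] K) →ₗ[ℂ] (E →L[ℂ] E)} {g : (L →L[ℂ] L) →ₗ[ℂ] (E →L[ℂ] E)}
  {X : (K →L[ℂ] K) ⊗[ℂ] Q} {Y : (L →L[ℂ] L) ⊗[ℂ] Q}

lemma star_rTensor_mul_rTensor_mul_self (fm : ∀ S T, f (S * T) = f S * f T)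
    (fs : ∀ S, f (star S) = star (f S)) (f1 : f 1 = 1) (gm : ∀ S T, g (S * T) = g S * g T)
    (gs : ∀ S, g (star S) = star (g S)) (g1 : g 1 = 1) (hX : star X * X = 1)
    (hY : star Y * Y = 1) :
    star (f.rTensor Q X * g.rTensor Q Y) * (f.rTensor Q X * g.rTensor Q Y) = 1 :=
  star_mul_self_mul_eq_one (rTensor_star_mul_self fm fs f1 hX) (rTensor_star_mul_self gm gs g1 hY)

/-- As `Q` is flat over `ℂ`, `g ⊗ id` is injective, so the identity may be checked on the image of
`Y`, where the isometric factor cancels. -/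
lemma mul_star_self_of_rTensor_mul_rTensor (fm : ∀ S T, f (S * T) = f S * f T)
    (fs : ∀ S, f (star S) = star (f S)) (f1 : f 1 = 1) (gm : ∀ S T, g (S * T) = g S * g T)
    (gs : ∀ S, g (star S) = star (g S)) (g1 : g 1 = 1) (hg : Function.Injective g)
    (hX : star X * X = 1)
    (hXY : (f.rTensor Q X * g.rTensor Q Y) * star (f.rTensor Q X * g.rTensor Q Y) = 1) :
    Y * star Y = 1 := by
  apply Module.Flat.rTensor_preserves_injective_linearMap (M := Q) g hg
  rw [rTensor_mul_star_self_eq gm gs, rTensor_map_one g1]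
  exact mul_star_self_right_eq_one (rTensor_star_mul_self fm fs f1 hX) hXY

end

lemma star_corepTensor_mul_self {X : (K →L[ℂ] K) ⊗[ℂ] Q} {Y : (L →L[ℂ] L) ⊗[ℂ] Q}
    (hX : star X * X = 1) (hY : star Y * Y = 1) :
    star (corepTensor X Y) * corepTensor X Y = 1 :=
  star_rTensor_mul_rTensor_mul_self HilbTensor.opₗ_flip_one_mul HilbTensor.opₗ_flip_one_star
    HilbTensor.op_one HilbTensor.opₗ_one_mul HilbTensor.opₗ_one_star HilbTensor.op_one hX hY

lemma mul_star_self_of_corepTensor [Nontrivial K] {X : (K →L[ℂ] K) ⊗[ℂ] Q}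
    {Y : (L →L[ℂ] L) ⊗[ℂ] Q} (hX : star X * X = 1)
    (hXY : corepTensor X Y * star (corepTensor X Y) = 1) : Y * star Y = 1 :=
  mul_star_self_of_rTensor_mul_rTensor HilbTensor.opₗ_flip_one_mul HilbTensor.opₗ_flip_one_star
    HilbTensor.op_one HilbTensor.opₗ_one_mul HilbTensor.opₗ_one_star HilbTensor.op_one
    HilbTensor.opₗ_one_injective hX hXY

/-- The tensor product of a right and a left projective corepresentation with inverse cocycles is a
corepresentation. -/
lemma CompactQuantumGroup.lTensor_comul_corepTensor {Ω : MinTensor Q Q}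
    (hΩ : Ω ∈ unitary (MinTensor Q Q)) {X : (K →L[ℂ] K) ⊗[ℂ] Q} {Y : (L →L[ℂ] L) ⊗[ℂ] Q}
    (hX : (G.comulRight Ω).lTensor _ X = leg₁₂ X * leg₁₃ X)
    (hY : (G.comulLeft (star Ω)).lTensor _ Y = leg₁₂ Y * leg₁₃ Y) :
    G.comul.toAlgHom.toLinearMap.lTensor _ (corepTensor X Y) =
      leg₁₂ (corepTensor X Y) * leg₁₃ (corepTensor X Y) := by
  rw [lTensor_comulRight] at hX
  rw [lTensor_comulLeft] at hY
  have e : ∀ (f : (K →L[ℂ] K) →ₗ[ℂ] (HilbTensor K L →L[ℂ] HilbTensor K L)),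
      G.comul.toAlgHom.toLinearMap.lTensor _ (f.rTensor Q X) =
      f.rTensor _ (G.comul.toAlgHom.toLinearMap.lTensor _ X) := fun f => by
    rw [← LinearMap.comp_apply, ← LinearMap.comp_apply, LinearMap.lTensor_comp_rTensor,
      LinearMap.rTensor_comp_lTensor]
  have e' : ∀ (f : (L →L[ℂ] L) →ₗ[ℂ] (HilbTensor K L →L[ℂ] HilbTensor K L)),
      G.comul.toAlgHom.toLinearMap.lTensor _ (f.rTensor Q Y) =
      f.rTensor _ (G.comul.toAlgHom.toLinearMap.lTensor _ Y) := fun f => by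
    rw [← LinearMap.comp_apply, ← LinearMap.comp_apply, LinearMap.lTensor_comp_rTensor,
      LinearMap.rTensor_comp_lTensor]
  have o1 : ∀ x : MinTensor Q Q, ((HilbTensor.opₗ K L).flip 1).rTensor _ (1 ⊗ₜ x) = 1 ⊗ₜ x :=
    fun x => by
      rw [LinearMap.rTensor_tmul]
      congr 1
      exact HilbTensor.op_one
  have o2 : ∀ x : MinTensor Q Q, (HilbTensor.opₗ K L 1).rTensor _ (1 ⊗ₜ x) = 1 ⊗ₜ x :=
    fun x => by
      rw [LinearMap.rTensor_tmul]
      congr 1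
      exact HilbTensor.op_one
  have hX' : G.comul.toAlgHom.toLinearMap.lTensor _ X = leg₁₂ X * leg₁₃ X * (1 ⊗ₜ star Ω) := by
    rw [← hX, mul_assoc, one_tmul_mul_one_tmul_minTensor, Unitary.mul_star_self_of_mem hΩ,
      one_tmul_one_minTensor, mul_one]
  have hY' : G.comul.toAlgHom.toLinearMap.lTensor _ Y = (1 ⊗ₜ Ω) * (leg₁₂ Y * leg₁₃ Y) := by
    rw [← hY, ← mul_assoc, one_tmul_mul_one_tmul_minTensor, Unitary.mul_star_self_of_mem hΩ,
      one_tmul_one_minTensor, one_mul]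
  have hcomm := rTensor_op_mul_comm (Q := Q) X Y
  rw [corepTensor, lTensor_comul_mul, e, e', hX', hY', leg₁₂_mul, leg₁₃_mul, leg₁₂_rTensor,
    leg₁₂_rTensor, leg₁₃_rTensor, leg₁₃_rTensor,
    rTensor_minTensor_mul HilbTensor.opₗ_flip_one_mul,
    rTensor_minTensor_mul HilbTensor.opₗ_flip_one_mul,
    rTensor_minTensor_mul HilbTensor.opₗ_one_mul,
    rTensor_minTensor_mul HilbTensor.opₗ_one_mul, o1, o2]
  generalize LinearMap.rTensor _ ((HilbTensor.opₗ K L).flip 1) (leg₁₂ X) = a at *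
  generalize LinearMap.rTensor _ ((HilbTensor.opₗ K L).flip 1) (leg₁₃ X) = b at *
  generalize LinearMap.rTensor _ (HilbTensor.opₗ K L 1) (leg₁₂ Y) = c at *
  generalize LinearMap.rTensor _ (HilbTensor.opₗ K L 1) (leg₁₃ Y) = d at *
  have ho : (1 : HilbTensor K L →L[ℂ] HilbTensor K L) ⊗ₜ[ℂ] star Ω * 1 ⊗ₜ Ω = 1 := by
    rw [one_tmul_mul_one_tmul_minTensor, Unitary.star_mul_self_of_mem hΩ, one_tmul_one_minTensor]
  -- `Ω*` stands at the right end of the factor from `X` and `Ω` at the left end of that from `Y`.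
  -- Once they cancel, the commuting inner legs are exchanged.
  calc _ = a * b * ((1 ⊗ₜ[ℂ] star Ω) * (1 ⊗ₜ Ω)) * (c * d) := by simp only [mul_assoc]
    _ = a * (b * c) * d := by rw [ho, mul_one]; simp only [mul_assoc]
    _ = a * c * (b * d) := by rw [hcomm]; simp only [mul_assoc]

end CorepTensor

/-! ### Operators on the conjugate space -/

namespace Conj

variable {H : Type v} [NormedAddCommGroup H] [InnerProductSpace ℂ H]

lemma barOp_mul (S T : H →L[ℂ] H) : barOp (S * T) = barOp S * barOp T := rfl

lemma barOp_one : barOp (1 : H →L[ℂ] H) = 1 := rfl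

lemma isUnit_barOp {T : H →L[ℂ] H} (hT : IsUnit T) : IsUnit (barOp T) := by
  obtain ⟨⟨T, S, hTS, hST⟩, rfl⟩ := hT
  exact ⟨⟨barOp T, barOp S, by rw [← barOp_mul, hTS, barOp_one],
    by rw [← barOp_mul, hST, barOp_one]⟩, rfl⟩

variable [CompleteSpace H]

lemma star_barOp (T : H →L[ℂ] H) : star (barOp T) = barOp (star T) := by
  refine ContinuousLinearMap.ext fun x => ext_inner_right ℂ fun y => ?_
  rw [ContinuousLinearMap.star_eq_adjoint, ContinuousLinearMap.adjoint_inner_left, inner_def,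
    inner_def, barOp_apply, barOp_apply, ContinuousLinearMap.star_eq_adjoint,
    AddEquiv.symm_apply_apply, AddEquiv.symm_apply_apply, ContinuousLinearMap.adjoint_inner_right]

lemma j_eq_barOp_star (T : H →L[ℂ] H) : j T = barOp (star T) := rfl

lemma j_mul (S T : H →L[ℂ] H) : j (S * T) = j T * j S := by
  rw [j_eq_barOp_star, star_mul, barOp_mul]
  rfl

lemma j_star (T : H →L[ℂ] H) : j (star T) = star (j T) := by
  rw [j_eq_barOp_star, j_eq_barOp_star, star_barOp]

lemma barOp_nonneg {T : H →L[ℂ] H} (hT : 0 ≤ T) : 0 ≤ barOp T := by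
  obtain ⟨S, rfl⟩ := CStarAlgebra.nonneg_iff_eq_star_mul_self.mp hT
  rw [barOp_mul, ← star_barOp]
  exact star_mul_self_nonneg _

/-- Uniqueness of the positive square root: the conjugate of `T^{1/2}` is positive and squares to
the conjugate of `T`. This matches the `R^{1/2}` defining `H̄_R` with `ρ^{1/2}`. -/
lemma barOp_rpow_half {T : H →L[ℂ] H} (hT : 0 ≤ T) :
    barOp T ^ (1 / 2 : ℝ) = barOp (T ^ (1 / 2 : ℝ)) := by
  rw [← CFC.sqrt_eq_rpow, ← CFC.sqrt_eq_rpow]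
  refine CFC.sqrt_unique ?_ (barOp_nonneg (CFC.sqrt_nonneg T))
  rw [← barOp_mul, CFC.sqrt_mul_sqrt_self T hT]

end Conj

/-! ### The density operator of a projective corepresentation -/

section Density

variable {Q : Type u} [CStarAlgebra Q] [PartialOrder Q] {H : Type v} [NormedAddCommGroup H]
  [InnerProductSpace ℂ H] [CompleteSpace H]

lemma traceHaar_eq_opTrace_sliceFunctional (h : Q →ₚ[ℂ] ℂ) (U : (H →L[ℂ] H) ⊗[ℂ] Q)
    (a : H →L[ℂ] H) :
    traceHaar h U a = opTrace H (sliceFunctional _ h (U * (a ⊗ₜ 1) * star U)) := by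
  rw [traceHaar]
  generalize U * (a ⊗ₜ 1) * star U = X
  induction X using TensorProduct.induction_on with
  | zero => simp
  | add X Y hX hY => simp only [map_add, hX, hY]
  | tmul S q =>
    rw [TensorProduct.map_tmul, LinearMap.mul'_apply, sliceFunctional_tmul, map_smul, smul_eq_mul,
      mul_comm]
    rfl

/-- For `X = S ⊗ p` and `Y = T ⊗ q`, cyclicity gives the density `h(pq) TS`. An anti-multiplicative
`f` restores the order `f(S) f(T)`, so `f(R)` is a slice of an honest product; with `f = j` this
produces `ρ`. -/
lemma exists_opTrace_sliceFunctional_eq {N : Type*} [Ring N] [Algebra ℂ N]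
    {f : (H →L[ℂ] H) →ₗ[ℂ] N} (hf : ∀ S T, f (S * T) = f T * f S) (h : Q →ₚ[ℂ] ℂ)
    (X Y : (H →L[ℂ] H) ⊗[ℂ] Q) :
    ∃ R : H →L[ℂ] H,
      (∀ a, opTrace H (sliceFunctional _ h (X * (a ⊗ₜ 1) * Y)) = opTrace H (R * a)) ∧
      f R = sliceFunctional _ h (f.rTensor Q X * f.rTensor Q Y) := by
  induction X using TensorProduct.induction_on with
  | zero => exact ⟨0, by simp⟩
  | add X X' hX hX' =>
    obtain ⟨R, h1, h2⟩ := hX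
    obtain ⟨R', h1', h2'⟩ := hX'
    exact ⟨R + R', fun a => by simp only [add_mul, map_add, h1, h1'],
      by simp only [add_mul, map_add, h2, h2']⟩
  | tmul S p =>
    induction Y using TensorProduct.induction_on with
    | zero => exact ⟨0, by simp⟩
    | add Y Y' hY hY' =>
      obtain ⟨R, h1, h2⟩ := hY
      obtain ⟨R', h1', h2'⟩ := hY'
      exact ⟨R + R', fun a => by simp only [add_mul, mul_add, map_add, h1, h1'],
        by simp only [mul_add, map_add, h2, h2']⟩
    | tmul T q =>
      refine ⟨h (p * q) • (T * S), fun a => ?_, ?_⟩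
      · rw [Algebra.TensorProduct.tmul_mul_tmul, Algebra.TensorProduct.tmul_mul_tmul, mul_one,
          sliceFunctional_tmul, smul_mul_assoc, map_smul, map_smul, opTrace_mul_comm, mul_assoc]
      · rw [LinearMap.rTensor_tmul, LinearMap.rTensor_tmul, Algebra.TensorProduct.tmul_mul_tmul,
          sliceFunctional_tmul, map_smul, hf]

/-- The trace pairing is nondegenerate: test on `a = (S - T)*`. -/
lemma eq_of_forall_opTrace_mul_eq [FiniteDimensional ℂ H] {S T : H →L[ℂ] H}
    (hST : ∀ a, opTrace H (S * a) = opTrace H (T * a)) : S = T := by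
  rw [← sub_eq_zero]
  apply eq_zero_of_opTrace_star_mul_self
  rw [opTrace_mul_comm, sub_mul, map_sub, hST, sub_self]

open ContinuousLinearMap InnerProductSpace in
/-- The functional `(Tr ⊗ h)(U (a ⊗ 1) U*)` is faithful for isometric `U`. -/
lemma CompactQuantumGroup.IsHaarState.isStrictlyPositive_of_traceHaar_eq [StarOrderedRing Q]
    [FiniteDimensional ℂ H]
    {G : CompactQuantumGroup Q} {h : Q →ₚ[ℂ] ℂ} (hh : G.IsHaarState h)
    {U : (H →L[ℂ] H) ⊗[ℂ] Q} (hU : star U * U = 1) {R : H →L[ℂ] H}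
    (hR : ∀ a, traceHaar h U a = opTrace H (R * a)) : IsStrictlyPositive R := by
  -- `ψ(TT*)` is `(Tr ⊗ h)(XX*)` with `X = U(T ⊗ 1)`, whereas `X*X = T*T ⊗ 1` because `U` is
  -- isometric.
  have key : ∀ T : H →L[ℂ] H, opTrace H (R * (T * star T)) =
      opTrace H (sliceFunctional _ h ((U * (T ⊗ₜ 1)) * star (U * (T ⊗ₜ 1)))) := fun T => by
    rw [← hR, traceHaar_eq_opTrace_sliceFunctional, star_mul, TensorProduct.star_tmul, star_one,
      mul_assoc U (T ⊗ₜ 1), ← mul_assoc (T ⊗ₜ[ℂ] (1 : Q)), Algebra.TensorProduct.tmul_mul_tmul,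
      mul_one, mul_assoc]
  have key' : ∀ T : H →L[ℂ] H, opTrace H (R * (T * star T)) = 0 → T = 0 := fun T hT => by
    rw [key] at hT
    have := hh.opTrace_star_mul_self_eq_zero hT
    rw [star_mul, mul_assoc, ← mul_assoc (star U), hU, one_mul, TensorProduct.star_tmul, star_one,
      Algebra.TensorProduct.tmul_mul_tmul, mul_one, sliceFunctional_tmul, hh.1, one_smul] at this
    exact eq_zero_of_opTrace_star_mul_self this
  -- Rank-one operators test `R` on single vectors: for `T = |v⟩⟨v|`, `TT* = ‖v‖² |v⟩⟨v|`.
  -- Positivity and injectivity of `R` are both read off from this value.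
  have hv : ∀ v : H, opTrace H (R * (rankOne ℂ v v * star (rankOne ℂ v v))) =
      (‖v‖ ^ 2 : ℂ) * ⟪v, R v⟫_ℂ := fun v => by
    rw [star_eq_adjoint, adjoint_rankOne, ContinuousLinearMap.mul_def, ContinuousLinearMap.mul_def,
      rankOne_comp_rankOne, comp_smul, comp_rankOne, map_smul, opTrace_rankOne, smul_eq_mul,
      inner_self_eq_norm_sq_to_K]
    rfl
  have hpos : ∀ v : H, 0 ≤ ⟪v, R v⟫_ℂ := fun v => by
    rcases eq_or_ne v 0 with rfl | hv0
    · simp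
    · have hn : (0 : ℂ) < (‖v‖ ^ 2 : ℂ) := by
        exact_mod_cast pow_pos (norm_pos_iff.mpr hv0) 2
      refine le_of_mul_le_mul_left ?_ hn
      rw [mul_zero, ← hv, key]
      exact opTrace_sliceFunctional_mul_star_nonneg h _
  have hR0 : 0 ≤ R := by
    rw [nonneg_iff_isPositive, isPositive_iff_complex]
    intro v
    have h0 := hpos v
    have h1 : ⟪R v, v⟫_ℂ = ⟪v, R v⟫_ℂ := by
      rw [← inner_conj_symm, Complex.conj_eq_iff_im]
      exact (Complex.nonneg_iff.mp h0).2.symm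
    rw [h1]
    exact ⟨(Complex.ext rfl (Complex.nonneg_iff.mp h0).2), (Complex.nonneg_iff.mp h0).1⟩
  have hinj : Function.Injective R := by
    rw [injective_iff_map_eq_zero]
    intro v hRv
    have := key' _ ((hv v).trans (by rw [hRv, inner_zero_right, mul_zero]))
    simpa using this
  refine IsUnit.isStrictlyPositive ?_ hR0
  rw [isUnit_iff_bijective]
  exact ⟨hinj, (LinearMap.injective_iff_surjective (f := R.toLinearMap)).mp hinj⟩

end Density

/-! ### Contragredients of projective corepresentations -/

section Cocycle

lemma star_assocConj {K L M : Type*} [NormedAddCommGroup K] [InnerProductSpace ℂ K]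
    [NormedAddCommGroup L] [InnerProductSpace ℂ L] [NormedAddCommGroup M] [InnerProductSpace ℂ M]
    (T : HilbTensor K (HilbTensor L M) →L[ℂ] HilbTensor K (HilbTensor L M)) :
    star (assocConj T) = assocConj (star T) := by
  refine ContinuousLinearMap.ext fun x => ext_inner_right ℂ fun y => ?_
  rw [ContinuousLinearMap.star_eq_adjoint, ContinuousLinearMap.adjoint_inner_left]
  change ⟪x, (HilbTensor.assoc K L M).symm (T (HilbTensor.assoc K L M y))⟫_ℂ =
    ⟪(HilbTensor.assoc K L M).symm (star T (HilbTensor.assoc K L M x)), y⟫_ℂ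
  rw [← LinearIsometryEquiv.inner_map_map (HilbTensor.assoc K L M),
    ← LinearIsometryEquiv.inner_map_map (HilbTensor.assoc K L M) _ y,
    LinearIsometryEquiv.apply_symm_apply, LinearIsometryEquiv.apply_symm_apply,
    ContinuousLinearMap.star_eq_adjoint, ContinuousLinearMap.adjoint_inner_left]

variable {Q : Type u} [CStarAlgebra Q] {G : CompactQuantumGroup Q}

variable (Δ : Q →⋆ₐ[ℂ] MinTensor Q Q) (x : MinTensor Q Q) (π₁ π₂ π₃ : HilbRep.{u} Q)

lemma star_comulTensorId_apply :
    star (comulTensorId Δ x π₁ π₂ π₃) = comulTensorId Δ (star x) π₁ π₂ π₃ :=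
  (map_star (MinTensor.eval (comulRep Δ π₁ π₂) π₃) x).symm

lemma star_idTensorComul_apply :
    star (idTensorComul Δ x π₁ π₂ π₃) = idTensorComul Δ (star x) π₁ π₂ π₃ :=
  (star_assocConj _).trans
    (congrArg assocConj (map_star (MinTensor.eval π₁ (comulRep Δ π₂ π₃)) x).symm)

lemma star_tensorOne_apply : star (tensorOne x π₁ π₂ π₃) = tensorOne (star x) π₁ π₂ π₃ := by
  rw [tensorOne, tensorOne, HilbTensor.star_op, star_one, map_star]

lemma star_oneTensor_apply : star (oneTensor x π₁ π₂ π₃) = oneTensor (star x) π₁ π₂ π₃ := by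
  rw [oneTensor, oneTensor, star_assocConj, HilbTensor.star_op, star_one, map_star]

/-- The adjoint of a right 2-cocycle is a left 2-cocycle. -/
lemma CompactQuantumGroup.IsRightCocycle.isLeftCocycle_star {Ω : MinTensor Q Q}
    (hΩ : G.IsRightCocycle Ω) : G.IsLeftCocycle (star Ω) := by
  refine ⟨Unitary.star_mem hΩ.1, funext fun π₁ => funext fun π₂ => funext fun π₃ => ?_⟩
  have h : idTensorComul G.comul Ω π₁ π₂ π₃ * oneTensor Ω π₁ π₂ π₃ =
      comulTensorId G.comul Ω π₁ π₂ π₃ * tensorOne Ω π₁ π₂ π₃ :=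
    congrFun (congrFun (congrFun hΩ.2 π₁) π₂) π₃
  have h' := congrArg star h
  rw [star_mul, star_mul, star_idTensorComul_apply, star_oneTensor_apply,
    star_comulTensorId_apply, star_tensorOne_apply] at h'
  exact h'

end Cocycle

/-! ### Passage from right to left projective identities, and the invariance of `ρ`. -/

section Antimultiplicative

variable {Q : Type u} [CStarAlgebra Q] {K : Type v} [NormedAddCommGroup K] [InnerProductSpace ℂ K]
  [CompleteSpace K] {E : Type v} [NormedAddCommGroup E] [InnerProductSpace ℂ E] [CompleteSpace E]
  {f : (K →L[ℂ] K) →ₗ[ℂ] (E →L[ℂ] E)}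

/-- The `Q`-components lie in different legs and commute, so reversing the order in `B(K)` reverses
the whole product. -/
lemma rTensor_leg₁₃_mul_leg₁₂ (hf : ∀ S T, f (S * T) = f T * f S) (X Y : (K →L[ℂ] K) ⊗[ℂ] Q) :
    f.rTensor _ (leg₁₃ X * leg₁₂ Y) = leg₁₂ (f.rTensor Q Y) * leg₁₃ (f.rTensor Q X) := by
  induction X using TensorProduct.induction_on with
  | zero => simp
  | add X X' hX hX' => simp only [map_add, add_mul, mul_add, hX, hX']
  | tmul S a =>
    induction Y using TensorProduct.induction_on with
    | zero => simp
    | add Y Y' hY hY' => simp only [map_add, add_mul, mul_add, hY, hY']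
    | tmul T b =>
      rw [leg₁₂_tmul, leg₁₃_tmul, tmul_mul_tmul_minTensor, LinearMap.rTensor_tmul,
        LinearMap.rTensor_tmul, LinearMap.rTensor_tmul, leg₁₂_tmul, leg₁₃_tmul,
        tmul_mul_tmul_minTensor, MinTensor.tmul_mul_tmul, MinTensor.tmul_mul_tmul, hf, one_mul,
        mul_one, one_mul, mul_one]

lemma rTensor_one_tmul_mul (x : MinTensor Q Q) (X : (K →L[ℂ] K) ⊗[ℂ] MinTensor Q Q) :
    f.rTensor _ ((1 ⊗ₜ x) * X) = (1 ⊗ₜ x) * f.rTensor _ X := by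
  induction X using TensorProduct.induction_on with
  | zero => simp
  | add X X' hX hX' => simp only [map_add, mul_add, hX, hX']
  | tmul S a =>
    rw [tmul_mul_tmul_minTensor, LinearMap.rTensor_tmul, LinearMap.rTensor_tmul,
      tmul_mul_tmul_minTensor, one_mul, one_mul]

/-- The adjoint of the right identity is `(1 ⊗ Ω*)(id ⊗ Δ)(X*) = (X*)₁₃ (X*)₁₂`; applying `f` puts
the legs back in the order required of a left projective corepresentation. -/
lemma CompactQuantumGroup.lTensor_comulLeft_rTensor_star {G : CompactQuantumGroup Q}
    (hf : ∀ S T, f (S * T) = f T * f S) {Ω : MinTensor Q Q} {X : (K →L[ℂ] K) ⊗[ℂ] Q}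
    (hX : (G.comulRight Ω).lTensor _ X = leg₁₂ X * leg₁₃ X) :
    (G.comulLeft (star Ω)).lTensor _ (f.rTensor Q (star X)) =
      leg₁₂ (f.rTensor Q (star X)) * leg₁₃ (f.rTensor Q (star X)) := by
  rw [lTensor_comulRight] at hX
  have h := congrArg star hX
  rw [star_mul_minTensor, star_mul_minTensor, star_leg₁₂, star_leg₁₃, ← lTensor_comul_star,
    TensorProduct.star_tmul, star_one] at h
  rw [lTensor_comulLeft, ← rTensor_leg₁₃_mul_leg₁₂ hf, ← h, rTensor_one_tmul_mul]
  congr 1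
  rw [← LinearMap.comp_apply, ← LinearMap.comp_apply, LinearMap.lTensor_comp_rTensor,
    LinearMap.rTensor_comp_lTensor]

/-- `V*(ρ ⊗ 1)V = ρ ⊗ 1` for a left projective corepresentation `V`, where `ρ = (id ⊗ h)(V*V)`. -/
lemma CompactQuantumGroup.IsHaarState.star_mul_sliceFunctional_mul [PartialOrder Q]
    [StarOrderedRing Q] {G : CompactQuantumGroup Q} {h : Q →ₚ[ℂ] ℂ} (hh : G.IsHaarState h)
    {Ω : MinTensor Q Q} (hΩ : Ω ∈ unitary (MinTensor Q Q)) {V : (K →L[ℂ] K) ⊗[ℂ] Q}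
    (hV : (G.comulLeft Ω).lTensor _ V = leg₁₂ V * leg₁₃ V) :
    star V * (sliceFunctional _ h (star V * V) ⊗ₜ 1) * V =
      sliceFunctional _ h (star V * V) ⊗ₜ 1 := by
  rw [lTensor_comulLeft] at hV
  have ho : (1 : K →L[ℂ] K) ⊗ₜ[ℂ] star Ω * 1 ⊗ₜ Ω = 1 := by
    rw [one_tmul_mul_one_tmul_minTensor, Unitary.star_mul_self_of_mem hΩ, one_tmul_one_minTensor]
  -- `Ω` sits on the left of `(id ⊗ Δ)(V)`, so it cancels in `V*V`. Slicing the second leg by `h`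
  -- then yields the claim.
  have hΔ : G.comul.toAlgHom.toLinearMap.lTensor _ (star V * V) =
      leg₁₃ (star V) * leg₁₂ (star V * V) * leg₁₃ V := by
    have e : star (leg₁₂ V * leg₁₃ V) * (leg₁₂ V * leg₁₃ V) =
        G.comul.toAlgHom.toLinearMap.lTensor _ (star V * V) := by
      rw [← hV, star_mul_minTensor, TensorProduct.star_tmul, star_one, mul_assoc,
        ← mul_assoc (1 ⊗ₜ[ℂ] star Ω), ho, one_mul, lTensor_comul_mul, lTensor_comul_star]
    rw [← e, star_mul_minTensor, star_leg₁₂, star_leg₁₃, leg₁₂_mul]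
    simp only [mul_assoc]
  rw [← lTensor_sliceLeft_leg_mul hh.1, ← hΔ, hh.lTensor_sliceLeft_comul]

end Antimultiplicative

/-! ### The twisted conjugate space -/

namespace Conj

variable {H : Type v} [NormedAddCommGroup H] [InnerProductSpace ℂ H] [CompleteSpace H]
  {R : H →L[ℂ] H}

lemma isStrictlyPositive_barOp (hR : IsStrictlyPositive R) : IsStrictlyPositive (barOp R) :=
  (isUnit_barOp hR.isUnit).isStrictlyPositive (barOp_nonneg hR.nonneg)

lemma barOp_rpow_mul_rpow_neg (hR : IsStrictlyPositive R) (x : ℝ) :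
    barOp R ^ x * barOp R ^ (-x) = 1 :=
  CFC.rpow_mul_rpow_neg x (isStrictlyPositive_barOp hR)

lemma barOp_rpow_half_mul_rpow_half (hR : IsStrictlyPositive R) :
    barOp R ^ (1 / 2 : ℝ) * barOp R ^ (1 / 2 : ℝ) = barOp R := by
  rw [barOp_rpow_half hR.nonneg, ← barOp_mul, ← CFC.sqrt_eq_rpow,
    CFC.sqrt_mul_sqrt_self _ hR.nonneg]

lemma star_barOp_rpow (R : H →L[ℂ] H) (x : ℝ) : star (barOp R ^ x) = barOp R ^ x :=
  (CFC.rpow_nonneg (a := barOp R) (y := x)).isSelfAdjoint.star_eq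

end Conj

namespace LinearIsometryEquiv

variable {E F : Type*} [NormedAddCommGroup E] [InnerProductSpace ℂ E] [CompleteSpace E]
  [NormedAddCommGroup F] [InnerProductSpace ℂ F] [CompleteSpace F] (e : F ≃ₗᵢ[ℂ] E)

/-- `LinearIsometryEquiv.conjStarAlgEquiv` as a linear map. -/
noncomputable def conjLinearMap : (F →L[ℂ] F) →ₗ[ℂ] (E →L[ℂ] E) where
  toFun := e.conjStarAlgEquiv
  map_add' S T := _root_.map_add e.conjStarAlgEquiv S T
  map_smul' c T := _root_.map_smul e.conjStarAlgEquiv c T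

lemma conjLinearMap_mul (S T : F →L[ℂ] F) :
    e.conjLinearMap (S * T) = e.conjLinearMap S * e.conjLinearMap T :=
  map_mul e.conjStarAlgEquiv S T

lemma conjLinearMap_star (T : F →L[ℂ] F) : e.conjLinearMap (star T) = star (e.conjLinearMap T) :=
  map_star e.conjStarAlgEquiv T

lemma conjLinearMap_one : e.conjLinearMap 1 = 1 := map_one e.conjStarAlgEquiv

lemma conjLinearMap_injective : Function.Injective e.conjLinearMap :=
  e.conjStarAlgEquiv.injective

end LinearIsometryEquiv

namespace TwistedConj

variable {H : Type v} [NormedAddCommGroup H] [InnerProductSpace ℂ H] [CompleteSpace H]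
  [FiniteDimensional ℂ H] (R : {R : H →L[ℂ] H // IsStrictlyPositive R})

lemma transfer_mul (S T : Conj H →L[ℂ] Conj H) :
    transfer R (S * T) = transfer R S * transfer R T := rfl

/-- The map `ā ↦ (R^{1/2} a)‾` as a unitary from `H̄_R` to `H̄`. -/
noncomputable def sqrtIsometry : TwistedConj R ≃ₗᵢ[ℂ] Conj H where
  toLinearEquiv := (equiv R).symm.trans
    (LinearEquiv.ofInjectiveEndo (sqrtMap R) (sqrtMap_injective R))
  norm_map' _ := rfl

/-- Conjugation with `sqrtIsometry`. -/
noncomputable def sqrtConj : (TwistedConj R →L[ℂ] TwistedConj R) →ₗ[ℂ] (Conj H →L[ℂ] Conj H) :=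
  (sqrtIsometry R).conjLinearMap

lemma sqrtConj_mul (S T : TwistedConj R →L[ℂ] TwistedConj R) :
    sqrtConj R (S * T) = sqrtConj R S * sqrtConj R T :=
  (sqrtIsometry R).conjLinearMap_mul S T

lemma sqrtConj_star (T : TwistedConj R →L[ℂ] TwistedConj R) :
    sqrtConj R (star T) = star (sqrtConj R T) :=
  (sqrtIsometry R).conjLinearMap_star T

lemma sqrtConj_one : sqrtConj R 1 = 1 := (sqrtIsometry R).conjLinearMap_one

lemma sqrtConj_injective : Function.Injective (sqrtConj R) :=
  (sqrtIsometry R).conjLinearMap_injective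

/-- The unitary `H̄_R → H̄` is `ρ^{1/2}` on underlying vectors, so it carries an operator `T`, left
unchanged on vectors by `transfer`, to `ρ^{1/2} T ρ^{-1/2}`. It suffices to check the relation
multiplied on the right by `ρ^{1/2}`. -/
lemma sqrtConj_transfer (T : Conj H →L[ℂ] Conj H) :
    sqrtConj R (transfer R T) = Conj.barOp (R : H →L[ℂ] H) ^ (1 / 2 : ℝ) * T *
      Conj.barOp (R : H →L[ℂ] H) ^ (-(1 / 2) : ℝ) := by
  have h : sqrtConj R (transfer R T) * Conj.barOp (R : H →L[ℂ] H) ^ (1 / 2 : ℝ) =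
      Conj.barOp (R : H →L[ℂ] H) ^ (1 / 2 : ℝ) * T := by
    rw [Conj.barOp_rpow_half R.2.nonneg]
    ext x
    exact congrArg (fun z => sqrtIsometry R (transfer R T z))
      ((sqrtIsometry R).symm_apply_apply (equiv R x))
  rw [← h, mul_assoc, Conj.barOp_rpow_mul_rpow_neg R.2, mul_one]

end TwistedConj

/-! ### Isometries and corepresentations under a change of Hilbert space. -/

section Twist

variable {Q : Type u} [CStarAlgebra Q] {E : Type v} [NormedAddCommGroup E] [InnerProductSpace ℂ E]
  [CompleteSpace E]

lemma star_rTensor_star {K : Type v} [NormedAddCommGroup K] [InnerProductSpace ℂ K]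
    [CompleteSpace K] {f : (K →L[ℂ] K) →ₗ[ℂ] (E →L[ℂ] E)} (hf : ∀ T, f (star T) = star (f T))
    (X : (K →L[ℂ] K) ⊗[ℂ] Q) : star (f.rTensor Q (star X)) = f.rTensor Q X := by
  rw [← rTensor_map_star hf, star_star]

/-- The product telescopes to `B(V*ρV)B = BρB = (BA)(AB) = 1`, suppressing `⊗ 1`. -/
lemma star_tmul_mul_tmul_mul_self {A B ρ : E →L[ℂ] E} (hA : star A = A) (hB : star B = B)
    (hAB : A * B = 1) (hρ : A * A = ρ) {V : (E →L[ℂ] E) ⊗[ℂ] Q}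
    (hV : star V * (ρ ⊗ₜ 1) * V = ρ ⊗ₜ 1) :
    star ((A ⊗ₜ 1) * V * (B ⊗ₜ 1)) * ((A ⊗ₜ 1) * V * (B ⊗ₜ 1)) = 1 := by
  have hBA : B * A = 1 := by
    have := congrArg star hAB
    rwa [star_mul, hA, hB, star_one] at this
  have hι : ∀ S T : E →L[ℂ] E, (S ⊗ₜ[ℂ] (1 : Q)) * (T ⊗ₜ 1) = (S * T) ⊗ₜ 1 := by simp
  calc _ = (B ⊗ₜ 1) * (star V * ((A ⊗ₜ 1) * (A ⊗ₜ 1)) * V) * (B ⊗ₜ[ℂ] (1 : Q)) := by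
        simp only [star_mul, TensorProduct.star_tmul, hA, hB, star_one, mul_assoc]
    _ = 1 := by
        rw [hι, hρ, hV, hι, hι, ← hρ, ← mul_assoc, hBA, one_mul, hAB,
          Algebra.TensorProduct.one_def]

lemma rTensor_rTensor_eq_tmul_mul {F : Type v} [NormedAddCommGroup F] [InnerProductSpace ℂ F]
    {A B : E →L[ℂ] E} {t : (E →L[ℂ] E) →ₗ[ℂ] (F →L[ℂ] F)} {θ : (F →L[ℂ] F) →ₗ[ℂ] (E →L[ℂ] E)}
    (h : ∀ T, θ (t T) = A * T * B) (V : (E →L[ℂ] E) ⊗[ℂ] Q) :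
    θ.rTensor Q (t.rTensor Q V) = (A ⊗ₜ 1) * V * (B ⊗ₜ 1) := by
  induction V using TensorProduct.induction_on with
  | zero => simp
  | add X Y hX hY => simp only [map_add, add_mul, mul_add, hX, hY]
  | tmul T q => simp [h]

lemma star_mul_self_of_rTensor {F : Type v} [NormedAddCommGroup F] [InnerProductSpace ℂ F]
    [CompleteSpace F] {θ : (F →L[ℂ] F) →ₗ[ℂ] (E →L[ℂ] E)} (hm : ∀ S T, θ (S * T) = θ S * θ T)
    (hs : ∀ T, θ (star T) = star (θ T)) (h1 : θ 1 = 1) (hi : Function.Injective θ)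
    {V : (F →L[ℂ] F) ⊗[ℂ] Q} (hV : star (θ.rTensor Q V) * θ.rTensor Q V = 1) :
    star V * V = 1 := by
  apply Module.Flat.rTensor_preserves_injective_linearMap (M := Q) θ hi
  rw [rTensor_map_mul hm, rTensor_map_star hs, hV, rTensor_map_one h1]

lemma CompactQuantumGroup.IsUnitaryLeftProjectiveCorep.rTensor {G : CompactQuantumGroup Q}
    {F : Type v} [NormedAddCommGroup F] [InnerProductSpace ℂ F]
    [CompleteSpace F] {θ : (F →L[ℂ] F) →ₗ[ℂ] (E →L[ℂ] E)} (hm : ∀ S T, θ (S * T) = θ S * θ T)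
    (hs : ∀ T, θ (star T) = star (θ T)) (h1 : θ 1 = 1)
    {V : (F →L[ℂ] F) ⊗[ℂ] Q} (hV : G.IsUnitaryLeftProjectiveCorep V) :
    G.IsUnitaryLeftProjectiveCorep (θ.rTensor Q V) := by
  obtain ⟨hV, Ω, hΩ, hVΩ⟩ := hV
  refine ⟨Unitary.mem_iff.mpr ⟨rTensor_star_mul_self hm hs h1 (Unitary.star_mul_self_of_mem hV),
    ?_⟩, Ω, hΩ, lTensor_rTensor_eq_leg_mul_leg hm hVΩ⟩
  rw [← rTensor_mul_star_self_eq hm hs, Unitary.mul_star_self_of_mem hV, rTensor_map_one h1]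

/-- The tensor product of an isometric right and an isometric left projective corepresentation with
inverse cocycles is a unitary corepresentation. -/
lemma CompactQuantumGroup.IsHaarState.isUnitaryCorep_corepTensor [PartialOrder Q]
    [StarOrderedRing Q] {G : CompactQuantumGroup Q} {h : Q →ₚ[ℂ] ℂ} (hh : G.IsHaarState h)
    [FiniteDimensional ℂ E] {F : Type v} [NormedAddCommGroup F] [InnerProductSpace ℂ F]
    [CompleteSpace F] [FiniteDimensional ℂ F] {Ω : MinTensor Q Q}
    (hΩ : Ω ∈ unitary (MinTensor Q Q)) {X : (E →L[ℂ] E) ⊗[ℂ] Q} {Y : (F →L[ℂ] F) ⊗[ℂ] Q}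
    (hX : star X * X = 1) (hY : star Y * Y = 1)
    (hXΩ : (G.comulRight Ω).lTensor _ X = leg₁₂ X * leg₁₃ X)
    (hYΩ : (G.comulLeft (star Ω)).lTensor _ Y = leg₁₂ Y * leg₁₃ Y) :
    G.IsUnitaryCorep (corepTensor X Y) :=
  have hc := lTensor_comul_corepTensor hΩ hXΩ hYΩ
  ⟨hh.mem_unitary_of_star_mul_self (star_corepTensor_mul_self hX hY) hc, hc⟩

lemma mul_star_self_eq_one_of_subsingleton [Subsingleton E] (Y : (E →L[ℂ] E) ⊗[ℂ] Q) :
    Y * star Y = 1 := by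
  have : (1 : (E →L[ℂ] E) ⊗[ℂ] Q) = 0 := by
    rw [Algebra.TensorProduct.one_def, Subsingleton.elim (1 : E →L[ℂ] E) 0,
      TensorProduct.zero_tmul]
  rw [← one_mul (Y * star Y), this, zero_mul]

end Twist

/-! ### The contragredient on `H̄` and on `H̄_R`. -/

section Contragredient

variable {Q : Type u} [CStarAlgebra Q] {H : Type v} [NormedAddCommGroup H]
  [InnerProductSpace ℂ H] [CompleteSpace H]

lemma star_contragredient (U : (H →L[ℂ] H) ⊗[ℂ] Q) :
    star (contragredient U) = Conj.j.rTensor Q U :=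
  star_rTensor_star (K := H) (E := Conj H) (f := Conj.j) Conj.j_star U

lemma CompactQuantumGroup.lTensor_comulLeft_contragredient {G : CompactQuantumGroup Q}
    {Ω : MinTensor Q Q} {U : (H →L[ℂ] H) ⊗[ℂ] Q}
    (hU : (G.comulRight Ω).lTensor _ U = leg₁₂ U * leg₁₃ U) :
    (G.comulLeft (star Ω)).lTensor _ (contragredient U) =
      leg₁₂ (contragredient U) * leg₁₃ (contragredient U) :=
  lTensor_comulLeft_rTensor_star Conj.j_mul hU

lemma exists_traceHaar_eq_opTrace [PartialOrder Q] (h : Q →ₚ[ℂ] ℂ) (U : (H →L[ℂ] H) ⊗[ℂ] Q) :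
    ∃ R : H →L[ℂ] H, (∀ a, traceHaar h U a = opTrace H (R * a)) ∧
      Conj.j R = sliceFunctional _ h (star (contragredient U) * contragredient U) := by
  obtain ⟨R, hR, hjR⟩ := exists_opTrace_sliceFunctional_eq (N := Conj H →L[ℂ] Conj H)
    (f := Conj.j) Conj.j_mul h U (star U)
  refine ⟨R, fun a => (traceHaar_eq_opTrace_sliceFunctional h U a).trans (hR a), ?_⟩
  rw [hjR, star_contragredient, contragredient]

lemma star_conjugateCorep_mul_self {U : (H →L[ℂ] H) ⊗[ℂ] Q} {R : H →L[ℂ] H}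
    (hR : IsStrictlyPositive R)
    (hU : star (contragredient U) * (Conj.barOp R ⊗ₜ 1) * contragredient U = Conj.barOp R ⊗ₜ 1) :
    star (conjugateCorep U R) * conjugateCorep U R = 1 :=
  star_tmul_mul_tmul_mul_self (Conj.star_barOp_rpow _ _) (Conj.star_barOp_rpow _ _)
    (Conj.barOp_rpow_mul_rpow_neg hR _) (Conj.barOp_rpow_half_mul_rpow_half hR) hU

variable [FiniteDimensional ℂ H] {U : (H →L[ℂ] H) ⊗[ℂ] Q}
  {R : {R : H →L[ℂ] H // IsStrictlyPositive R}}

variable (U R) in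
-- The two elements are one operator matrix seen in unitarily equivalent spaces, so isometry,
-- unitarity and the projective identity can be moved between `H̄_R` and `H̄`.
lemma rTensor_sqrtConj_contragredientTwisted :
    (TwistedConj.sqrtConj R).rTensor Q (contragredientTwisted U R) = conjugateCorep U R.1 :=
  rTensor_rTensor_eq_tmul_mul (TwistedConj.sqrtConj_transfer R) (contragredient U)

lemma star_contragredientTwisted_mul_self
    (hU : star (contragredient U) * (Conj.barOp R.1 ⊗ₜ 1) * contragredient U =
      Conj.barOp R.1 ⊗ₜ 1) :
    star (contragredientTwisted U R) * contragredientTwisted U R = 1 := by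
  refine star_mul_self_of_rTensor (TwistedConj.sqrtConj_mul R) (TwistedConj.sqrtConj_star R)
    (TwistedConj.sqrtConj_one R) (TwistedConj.sqrtConj_injective R) ?_
  rw [rTensor_sqrtConj_contragredientTwisted]
  exact star_conjugateCorep_mul_self R.2 hU

lemma lTensor_contragredientTwisted {g : Q →ₗ[ℂ] MinTensor Q Q}
    (hU : g.lTensor _ (contragredient U) = leg₁₂ (contragredient U) * leg₁₃ (contragredient U)) :
    g.lTensor _ (contragredientTwisted U R) =
      leg₁₂ (contragredientTwisted U R) * leg₁₃ (contragredientTwisted U R) :=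
  lTensor_rTensor_eq_leg_mul_leg (TwistedConj.transfer_mul R) hU

lemma CompactQuantumGroup.isUnitaryLeftProjectiveCorep_conjugateCorep {G : CompactQuantumGroup Q}
    (hU : G.IsUnitaryLeftProjectiveCorep (contragredientTwisted U R)) :
    G.IsUnitaryLeftProjectiveCorep (conjugateCorep U R.1) := by
  rw [← rTensor_sqrtConj_contragredientTwisted]
  exact hU.rTensor (TwistedConj.sqrtConj_mul R) (TwistedConj.sqrtConj_star R)
    (TwistedConj.sqrtConj_one R)

lemma contragredientTwisted_mem_unitary (hUs : star U * U = 1)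
    (hU : star (contragredientTwisted U R) * contragredientTwisted U R = 1)
    (hc : corepTensor U (contragredientTwisted U R) *
      star (corepTensor U (contragredientTwisted U R)) = 1) :
    contragredientTwisted U R ∈ unitary ((TwistedConj R →L[ℂ] TwistedConj R) ⊗[ℂ] Q) := by
  refine Unitary.mem_iff.mpr ⟨hU, ?_⟩
  -- For `H = 0` the embedding `T ↦ 1 ⊗ T` is not available as an injective test, but then `B(H̄_R)
  -- ⊗ Q` is the zero ring.
  rcases subsingleton_or_nontrivial H with hH | hH
  · have : Subsingleton (TwistedConj R) := hH
    exact mul_star_self_eq_one_of_subsingleton _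
  · exact mul_star_self_of_corepTensor hUs hc

end Contragredient

theorem mainTheorem2 {Q : Type*} [CStarAlgebra Q] [PartialOrder Q] [StarOrderedRing Q]
    (G : CompactQuantumGroup Q) (h : Q →ₚ[ℂ] ℂ) (hh : G.IsHaarState h)
    {H : Type*} [NormedAddCommGroup H] [InnerProductSpace ℂ H] [CompleteSpace H]
    [FiniteDimensional ℂ H]
    (U : (H →L[ℂ] H) ⊗[ℂ] Q) (hU : G.IsUnitaryRightProjectiveCorep U) :
    ∃ R : {R : H →L[ℂ] H // IsStrictlyPositive R},
      (∀ a : H →L[ℂ] H, traceHaar h U a = opTrace H (R * a)) ∧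
      (∀ R' : H →L[ℂ] H, (∀ a : H →L[ℂ] H, traceHaar h U a = opTrace H (R' * a)) → R' = R) ∧
      G.IsUnitaryCorep (corepTensor U (contragredientTwisted U R)) ∧
      contragredientTwisted U R ∈ unitary ((TwistedConj R →L[ℂ] TwistedConj R) ⊗[ℂ] Q) ∧
      G.IsUnitaryLeftProjectiveCorep (conjugateCorep U (R : H →L[ℂ] H)) := by
  obtain ⟨hU, Ω, hΩ, hUΩ⟩ := hU
  have hUs := Unitary.star_mul_self_of_mem hU
  obtain ⟨R₀, hψ, hjR⟩ := exists_traceHaar_eq_opTrace h U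
  obtain ⟨R, rfl⟩ : ∃ R : {R : H →L[ℂ] H // IsStrictlyPositive R}, R.1 = R₀ :=
    ⟨⟨R₀, hh.isStrictlyPositive_of_traceHaar_eq hUs hψ⟩, rfl⟩
  -- Self-adjointness of `R` identifies `j(R)` with `ρ`, so the Haar average of `V*V` is the
  -- operator that defines `H̄_R`.
  rw [Conj.j_eq_barOp_star, R.2.isSelfAdjoint.star_eq] at hjR
  have hV := CompactQuantumGroup.lTensor_comulLeft_contragredient hUΩ
  have hVρ := hh.star_mul_sliceFunctional_mul (Unitary.star_mem hΩ.1) hV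
  rw [← hjR] at hVρ
  have hiso := star_contragredientTwisted_mul_self hVρ
  have hVR := lTensor_contragredientTwisted (R := R) hV
  -- Only isometry of `V` over `H̄_R` is known so far; its unitarity is deduced afterwards from that
  -- of the tensor product.
  have hcorep := hh.isUnitaryCorep_corepTensor hΩ.1 hUs hiso hUΩ hVR
  have hunit := contragredientTwisted_mem_unitary hUs hiso
    (Unitary.mul_star_self_of_mem hcorep.1)
  exact ⟨R, hψ, fun R' hR' => eq_of_forall_opTrace_mul_eq fun a => (hR' a).symm.trans (hψ a),
    hcorep, hunit, CompactQuantumGroup.isUnitaryLeftProjectiveCorep_conjugateCorep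
      ⟨hunit, star Ω, hΩ.isLeftCocycle_star, hVR⟩⟩
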